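/- Let $n\ge 1$ be an integer and $T>0$ a real number. Let $\Omega'\subset\mathbb R\times\mathbb R^{n}$ be bounded, open and connected, let $\Omega=\Omega'\cap([0,T]\times\mathbb R^n)$, and let $\Omega_t=\{x\in\mathbb R^n:(t,x)\in\Omega\}$, $t\in[0,T]$; assume that every $\Omega_t$, $t\in[0,T]$, is non-empty, bounded and connected. Write $\overline\Omega_t$, $\partial\Omega_t$, $\Omega_t^c$ for the closure, boundary and complement of $\Omega_t$ in $\mathbb R^n$, and $B(a,b)=\{x\in\mathbb R^n:|x-a|\le b\}$. Let $\gamma\in\mathcal C^{1,2}([0,T]\times\mathbb R^n,\mathbb R^n)$, i.e. $\gamma$, $D_t\gamma$ (one-sided at $t=0,T$), $D_x\gamma$ and $D_x^2\gamma$ exist and are continuous on $[0,T]\times\mathbb R^n$. Assume: 1. $|\gamma(t,x)|=1$ for all $t\in[0,T]$, $x\in\partial\Omega_t$; 2. there is $\rho\in(0,1)$ such that $\bigcup_{0\le\zeta\le\rho}B(x-\zeta\gamma(t,x),\zeta\rho)\subset\Omega_t^c$ for all $t\in[0,T]$, $x\in\partial\Omega_t$; 3. for every $x\in\mathbb R^n$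 the function $t\mapsto d(t,x)=\inf_{y\in\Omega_t}|x-y|$ is in the Sobolev space $\mathcal H^1([0,T])$, i.e. it is continuous on $[0,T]$ and has a weak derivative in $L^2(0,T)$. Then for every continuous $\psi:[0,T]\to\mathbb R^n$ with $\psi(0)\in\overline\Omega_0$ the Skorohod problem for $(\Omega,\gamma,\psi)$ has a solution: there are continuous functions $\phi,\lambda:[0,T]\to\mathbb R^n$ such that, with $|\lambda|(t)$ the total variation of $\lambda$ over $[0,t]$, for all $t\in[0,T]$, $$\phi(t)=\psi(t)+\lambda(t),\qquad \phi(0)=\psi(0),\qquad \phi(t)\in\overline\Omega_t,\qquad |\lambda|(T)<\infty,$$ $$|\lambda|(t)=\int_{(0,t]}I_{\{\phi(s)\in\partial\Omega_s\}}\,d|\lambda|(s),\qquad \lambda(t)=\int_{(0,t]}\widehat\gamma(s)\,d|\lambda|(s),$$ for some measurable, $d|\lambda|$-integrable function $\widehat\gamma$ with values in $\mathbb R^n$ satisfying $\widehat\gamma(s)=\gamma(s,\phi(s))$ for $d|\lambda|$-almost every $s$. -/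

import Mathlib

open Set MeasureTheory
open scoped ContDiff ENNReal

namespace ObliqueSkorohod

/-- The time section `Ω_t = {x | (t, x) ∈ Ω}`. -/
def timeSection {n : ℕ} (Ω : Set (ℝ × EuclideanSpace ℝ (Fin n))) (t : ℝ) :
    Set (EuclideanSpace ℝ (Fin n)) :=
  {x | (t, x) ∈ Ω}

/-- `Ω` is a time-dependent domain over `[0, T]`: the part in `[0, T] × ℝⁿ` of a bounded, open,
connected subset of `ℝⁿ⁺¹`, all of whose time sections are nonempty, connected and bounded
(`IsConnected` includes nonemptiness). -/
structure IsTimeDependentDomain {n : ℕ} (T : ℝ) (Ω : Set (ℝ × EuclideanSpace ℝ (Fin n))) :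
    Prop where
  exists_open : ∃ Ω' : Set (ℝ × EuclideanSpace ℝ (Fin n)),
    IsOpen Ω' ∧ IsConnected Ω' ∧ Bornology.IsBounded Ω' ∧
      Ω = Ω' ∩ (Icc (0 : ℝ) T ×ˢ univ)
  isConnected_section : ∀ t ∈ Icc (0 : ℝ) T, IsConnected (timeSection Ω t)
  isBounded_section : ∀ t ∈ Icc (0 : ℝ) T, Bornology.IsBounded (timeSection Ω t)

/-- `γ ∈ C^{1,2}([0, T] × ℝⁿ, ℝⁿ)`: `γ`, its first time derivative (one-sided at the end points)
and its first and second space derivatives exist and are jointly continuous on `[0, T] × ℝⁿ`. -/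
structure IsC12 {n : ℕ} (T : ℝ)
    (γ : ℝ → EuclideanSpace ℝ (Fin n) → EuclideanSpace ℝ (Fin n)) : Prop where
  continuousOn : ContinuousOn (fun p : ℝ × EuclideanSpace ℝ (Fin n) => γ p.1 p.2)
    (Icc (0 : ℝ) T ×ˢ univ)
  differentiableOn_time : ∀ x, DifferentiableOn ℝ (fun t => γ t x) (Icc (0 : ℝ) T)
  continuousOn_time_deriv : ContinuousOn
    (fun p : ℝ × EuclideanSpace ℝ (Fin n) => derivWithin (fun t => γ t p.2) (Icc (0 : ℝ) T) p.1)
    (Icc (0 : ℝ) T ×ˢ univ)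
  contDiff_space : ∀ t ∈ Icc (0 : ℝ) T, ContDiff ℝ 2 (γ t)
  continuousOn_fderiv : ContinuousOn
    (fun p : ℝ × EuclideanSpace ℝ (Fin n) => fderiv ℝ (γ p.1) p.2)
    (Icc (0 : ℝ) T ×ˢ univ)
  continuousOn_fderiv_fderiv : ContinuousOn
    (fun p : ℝ × EuclideanSpace ℝ (Fin n) => fderiv ℝ (fderiv ℝ (γ p.1)) p.2)
    (Icc (0 : ℝ) T ×ˢ univ)

/-- `f ∈ H¹([0, T])`, for the everywhere defined (continuous) representative: `f` is continuous on
`[0, T]` and has a weak derivative in `L²(0, T)`. -/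
structure MemH1 (T : ℝ) (f : ℝ → ℝ) : Prop where
  continuousOn : ContinuousOn f (Icc (0 : ℝ) T)
  exists_weakDeriv : ∃ g : ℝ → ℝ, MemLp g 2 (volume.restrict (Ioo (0 : ℝ) T)) ∧
    ∀ η : ℝ → ℝ, ContDiff ℝ ∞ η → HasCompactSupport η → tsupport η ⊆ Ioo (0 : ℝ) T →
      ∫ t in Ioo (0 : ℝ) T, f t * deriv η t = -∫ t in Ioo (0 : ℝ) T, g t * η t

/-- The standing assumptions on a time-dependent domain `Ω` and the direction of reflection `γ`. -/
structure IsAdmissible {n : ℕ} (T : ℝ) (Ω : Set (ℝ × EuclideanSpace ℝ (Fin n)))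
    (γ : ℝ → EuclideanSpace ℝ (Fin n) → EuclideanSpace ℝ (Fin n)) : Prop where
  isTimeDependentDomain : IsTimeDependentDomain T Ω
  isC12 : IsC12 T γ
  /-- The direction of reflection is a unit vector at each boundary point. -/
  norm_eq_one : ∀ t ∈ Icc (0 : ℝ) T, ∀ x ∈ frontier (timeSection Ω t), ‖γ t x‖ = 1
  /-- The uniform exterior cone condition. -/
  exterior_cone : ∃ ρ ∈ Ioo (0 : ℝ) 1, ∀ t ∈ Icc (0 : ℝ) T, ∀ x ∈ frontier (timeSection Ω t),
    (⋃ ζ ∈ Icc (0 : ℝ) ρ, Metric.closedBall (x - ζ • γ t x) (ζ * ρ)) ⊆ (timeSection Ω t)ᶜ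
  /-- The temporal regularity: `d(·, x) ∈ H¹([0, T])` for each `x`, with `d(t, x)` the distance from
  `x` to `Ω_t`. -/
  memH1_dist : ∀ x, MemH1 T (fun t => Metric.infDist x (timeSection Ω t))

/-- The function `t ↦ |f|(t)`, the total variation of `f` over `[0, t]`, extended to all of `ℝ` by
`0` on the left of `0` and by `|f|(T)` on the right of `T`. -/
noncomputable def totalVariation {n : ℕ} (T : ℝ) (f : ℝ → EuclideanSpace ℝ (Fin n)) (t : ℝ) : ℝ :=
  (eVariationOn f (Icc 0 (min t T))).toReal

theorem monotone_totalVariation {n : ℕ} {T : ℝ} {f : ℝ → EuclideanSpace ℝ (Fin n)}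
    (hf : BoundedVariationOn f (Icc 0 T)) : Monotone (totalVariation T f) := fun _ _ h =>
  ENNReal.toReal_mono (hf.mono (Icc_subset_Icc_right (min_le_right _ _)))
    (eVariationOn.mono f (Icc_subset_Icc_right (min_le_min_right T h)))

/-- The Lebesgue–Stieltjes measure `d|f|` of a function `f` of bounded variation on `[0, T]`. -/
noncomputable def variationMeasure {n : ℕ} {T : ℝ} {f : ℝ → EuclideanSpace ℝ (Fin n)}
    (hf : BoundedVariationOn f (Icc 0 T)) : Measure ℝ :=
  (monotone_totalVariation hf).stieltjesFunction.measure

/-- `(φ, l)` is a solution to the Skorohod problem for `(Ω, γ, ψ)` on `[0, T]`. -/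
structure IsSkorohodSolution {n : ℕ} (T : ℝ) (Ω : Set (ℝ × EuclideanSpace ℝ (Fin n)))
    (γ : ℝ → EuclideanSpace ℝ (Fin n) → EuclideanSpace ℝ (Fin n))
    (ψ φ l : ℝ → EuclideanSpace ℝ (Fin n)) : Prop where
  continuousOn_fst : ContinuousOn φ (Icc (0 : ℝ) T)
  continuousOn_snd : ContinuousOn l (Icc (0 : ℝ) T)
  eq_add : ∀ t ∈ Icc (0 : ℝ) T, φ t = ψ t + l t
  initial : φ 0 = ψ 0
  mem_closure : ∀ t ∈ Icc (0 : ℝ) T, φ t ∈ closure (timeSection Ω t)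
  boundedVariation : BoundedVariationOn l (Icc (0 : ℝ) T)
  /-- `|l|` increases only while `φ` is on the boundary. -/
  boundary : ∀ t ∈ Icc (0 : ℝ) T,
    eVariationOn l (Icc 0 t) =
      ∫⁻ s in Ioc 0 t, {s | φ s ∈ frontier (timeSection Ω s)}.indicator (fun _ => (1 : ℝ≥0∞)) s
        ∂(variationMeasure boundedVariation)
  /-- `l` acts in the direction `γ`. -/
  direction : ∃ γ' : ℝ → EuclideanSpace ℝ (Fin n), Measurable γ' ∧
    (∀ᵐ s ∂(variationMeasure boundedVariation), γ' s = γ s (φ s)) ∧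
    IntegrableOn γ' (Ioc 0 T) (variationMeasure boundedVariation) ∧
    ∀ t ∈ Icc (0 : ℝ) T, l t = ∫ s in Ioc 0 t, γ' s ∂(variationMeasure boundedVariation)

end ObliqueSkorohod

namespace ObliqueSkorohod

open Filter Topology Metric

/-! ### Exterior and interior cones. -/

section Cone

variable {E : Type*} [NormedAddCommGroup E] [NormedSpace ℝ E]

/-! Where `γ` is nearly constant, the exterior cones opening along `-γ` force an interior cone: from
any point of the closure, a move of length parameter `L` along `γ`, with an error below `ρ / 2 * L`,
lands inside the open domain (`add_mem_of_exterior_cone`). This drives both the construction and the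
compactness.

Discretize time: follow the increment of `ψ`, and if the result leaves the domain, push it along `γ`
until it meets the boundary (`exists_step`). The pushes over a short time cannot accumulate: if
their total exceeded a small threshold, they would dominate the increment of `ψ` and the motion of
the domain, so the interior cone would place the node inside the domain, whereas a nonzero push ends
on the boundary (`exists_pushLength_le`). This bound does not depend on the mesh.

Pointwise limits along an ultrafilter then give a push `l` and a length `v` whose increments over
short intervals satisfy `dl ≈ γ dv` and `|γ| dv ≈ dv`, with errors at most `η dv`, while `v` is
locally constant in time when the path is inside (`exists_isLimitPush`). Since errors of the form `η
dv` add up to at most `η v` (`dist_le_of_local`), letting `η → 0` turns these local approximations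
into `v = |l|` and `l = ∫ γ d|l|`. -/

theorem exists_mem_segment_frontier {D : Set E} {p q : E} (hp : p ∉ D) (hq : q ∈ D) :
    ∃ z ∈ segment ℝ p q, z ∈ frontier D := by
  by_contra! h
  have hpre : IsPreconnected (segment ℝ p q) := (convex_segment p q).isPreconnected
  have hcl : ∀ z ∈ segment ℝ p q, z ∈ closure D → z ∈ interior D := fun z hz hzc => by
    by_contra hzi
    exact h z hz ⟨hzc, hzi⟩
  obtain ⟨z, -, hz1, hz2⟩ := hpre (interior D) (closure D)ᶜ isOpen_interior
    isClosed_closure.isOpen_compl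
    (fun z hz => by
      by_cases hzc : z ∈ closure D
      · exact Or.inl (hcl z hz hzc)
      · exact Or.inr hzc)
    ⟨q, right_mem_segment ℝ p q, hcl q (right_mem_segment ℝ p q) (subset_closure hq)⟩
    ⟨p, left_mem_segment ℝ p q, fun hpc =>
      hp (interior_subset (hcl p (left_mem_segment ℝ p q) hpc))⟩
  exact hz2 (subset_closure (interior_subset hz1))

/-- An exterior cone condition with nearly constant axis yields an interior cone condition. -/
theorem add_mem_of_exterior_cone {D : Set E} {c : E → E} {ρ L r : ℝ} {y g w : E}
    (hcone : ∀ z ∈ frontier D, ∀ ζ ∈ Icc 0 ρ, closedBall (z - ζ • c z) (ζ * ρ) ⊆ Dᶜ)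
    (hy : y ∈ closure D) (hL : 0 < L) (hLρ : L ≤ ρ) (hw : ‖w‖ < ρ / 2 * L) (hr : 0 < r)
    (hp : ‖L • g + w‖ ≤ r) (hc : ∀ z ∈ frontier D, dist z y ≤ r → ‖c z - g‖ ≤ ρ / 2) :
    y + (L • g + w) ∈ D := by
  by_contra hpD
  obtain ⟨y', hy'D, hy'⟩ := Metric.mem_closure_iff.1 hy (min r (ρ / 2 * L - ‖w‖))
    (lt_min hr (by linarith))
  obtain ⟨z, hz, hzf⟩ := exists_mem_segment_frontier hpD hy'D
  have hzy : dist z y ≤ r := by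
    have : segment ℝ (y + (L • g + w)) y' ⊆ closedBall y r :=
      (convex_closedBall y r).segment_subset (by simpa [dist_eq_norm] using hp)
        (by rw [mem_closedBall, dist_comm]; exact hy'.le.trans (min_le_left _ _))
    exact this hz
  have hcz := hc z hzf hzy
  obtain ⟨a, b, ha, hb, hab, rfl⟩ := hz
  set z := a • (y + (L • g + w)) + b • y' with hzdef
  have ha1 : a ≤ 1 := by linarith
  -- The exterior cone at `z`, at height `a * L`, captures `y' ∈ D`: going back from `z` by `a * L`
  -- along `c z` undoes the fraction `a` of the move, up to an error `a * (L * ρ)`.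
  refine hcone z hzf (a * L) ⟨by positivity, by nlinarith⟩ ?_ hy'D
  rw [mem_closedBall, dist_eq_norm]
  have hy'' : ‖y' - y‖ ≤ ρ / 2 * L - ‖w‖ := by
    rw [← dist_eq_norm, dist_comm]; exact hy'.le.trans (min_le_right _ _)
  have e : y' - (z - (a * L) • c z) = a • ((y' - y) - w + L • (c z - g)) := by
    have hb' : b = 1 - a := by linarith
    rw [hzdef, hb']
    module
  rw [e, norm_smul, Real.norm_of_nonneg ha]
  have h1 : ‖(y' - y) - w + L • (c z - g)‖ ≤ ‖y' - y‖ + ‖w‖ + L * (ρ / 2) := by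
    refine (norm_add_le _ _).trans (add_le_add (norm_sub_le _ _) ?_)
    rw [norm_smul, Real.norm_of_nonneg hL.le]
    gcongr
  calc a * _ ≤ a * (L * ρ) := by
        gcongr
        linarith
    _ = a * L * ρ := by ring

end Cone

/-! ### Uniform estimates for the moving domain. -/

/-- Quantitative properties, uniform in time, of a continuously moving family of open sets with a
continuous direction field `γ` obeying an exterior cone condition. -/
structure IsUniformDomain {E : Type*} [NormedAddCommGroup E] [NormedSpace ℝ E] (T R ρ M : ℝ)
    (D : ℝ → Set E) (γ : ℝ → E → E) : Prop where
  rho_pos : 0 < ρ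
  isOpen : ∀ t ∈ Icc 0 T, IsOpen (D t)
  nonempty : ∀ t ∈ Icc 0 T, (D t).Nonempty
  closure_subset : ∀ t ∈ Icc 0 T, closure (D t) ⊆ closedBall 0 R
  cone : ∀ t ∈ Icc 0 T, ∀ z ∈ frontier (D t), ∀ ζ ∈ Icc 0 ρ,
    closedBall (z - ζ • γ t z) (ζ * ρ) ⊆ (D t)ᶜ
  norm_eq_one : ∀ t ∈ Icc 0 T, ∀ z ∈ frontier (D t), ‖γ t z‖ = 1
  continuousOn : ContinuousOn (fun p : ℝ × E => γ p.1 p.2) (Icc 0 T ×ˢ univ)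
  norm_le : ∀ t ∈ Icc 0 T, ∀ x ∈ closedBall (0 : E) (R + 1), ‖γ t x‖ ≤ M
  modulus_direction : ∀ ε > 0, ∃ r > 0, ∀ s ∈ Icc 0 T, ∀ t ∈ Icc 0 T,
    ∀ x ∈ closedBall (0 : E) (R + 1), ∀ y ∈ closedBall (0 : E) (R + 1),
    |s - t| ≤ r → dist x y ≤ r → ‖γ s x - γ t y‖ ≤ ε
  modulus_dist : ∀ ε > 0, ∃ h > 0, ∀ s ∈ Icc 0 T, ∀ t ∈ Icc 0 T, |s - t| ≤ h →
    ∀ x ∈ closure (D s), infDist x (D t) ≤ ε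
  open_time : ∀ s ∈ Icc 0 T, ∀ x ∈ D s, ∃ h > 0, ∀ t ∈ Icc 0 T, |t - s| ≤ h →
    ∀ y, dist y x ≤ h → y ∈ D t

/-- The distance is 1-Lipschitz in space and continuous in time, hence jointly continuous;
compactness of `[0, T]` times a ball makes it and `γ` uniformly continuous. The radius `R + 1`
leaves room for points slightly outside the domain. -/
theorem exists_isUniformDomain {E : Type*} [NormedAddCommGroup E] [NormedSpace ℝ E] [ProperSpace E]
    {T ρ : ℝ} {D : ℝ → Set E} {γ : ℝ → E → E} {U : Set (ℝ × E)} (hUo : IsOpen U)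
    (hUb : Bornology.IsBounded U) (hsec : ∀ t ∈ Icc 0 T, ∀ x, x ∈ D t ↔ (t, x) ∈ U)
    (hne : ∀ t ∈ Icc 0 T, (D t).Nonempty)
    (hγ : ContinuousOn (fun p : ℝ × E => γ p.1 p.2) (Icc 0 T ×ˢ univ))
    (hγ1 : ∀ t ∈ Icc 0 T, ∀ z ∈ frontier (D t), ‖γ t z‖ = 1) (hρ : 0 < ρ)
    (hcone : ∀ t ∈ Icc 0 T, ∀ z ∈ frontier (D t), ∀ ζ ∈ Icc 0 ρ,
      closedBall (z - ζ • γ t z) (ζ * ρ) ⊆ (D t)ᶜ)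
    (hdist : ∀ x, ContinuousOn (fun t => infDist x (D t)) (Icc 0 T)) :
    ∃ R M, IsUniformDomain T R ρ M D γ := by
  obtain ⟨R, hR⟩ := hUb.subset_closedBall (0 : ℝ × E)
  have hsub : ∀ t ∈ Icc (0 : ℝ) T, closure (D t) ⊆ closedBall 0 R := fun t ht =>
    closure_minimal (fun x hx => by
      have := hR ((hsec t ht x).1 hx)
      rw [mem_closedBall, Prod.dist_eq] at this
      exact (le_max_right _ _).trans this) isClosed_closedBall
  have hcpt : IsCompact (Icc (0 : ℝ) T ×ˢ closedBall (0 : E) (R + 1)) :=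
    isCompact_Icc.prod (isCompact_closedBall _ _)
  have hss : Icc (0 : ℝ) T ×ˢ closedBall (0 : E) (R + 1) ⊆ Icc (0 : ℝ) T ×ˢ univ :=
    prod_mono (Subset.refl _) (subset_univ _)
  obtain ⟨M, hM⟩ := hcpt.exists_bound_of_continuousOn (hγ.mono hss)
  have hlip : ∀ t ∈ Icc (0 : ℝ) T, LipschitzOnWith 1 (fun x => infDist x (D t)) univ :=
    fun t _ => (lipschitz_infDist_pt (D t)).lipschitzOnWith
  have hdist' : ContinuousOn (fun p : ℝ × E => infDist p.2 (D p.1)) (Icc 0 T ×ˢ univ) :=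
    continuousOn_prod_of_continuousOn_lipschitzOnWith'
      (fun p : ℝ × E => infDist p.2 (D p.1)) 1 hlip (fun x _ => hdist x)
  have hud := hcpt.uniformContinuousOn_of_continuous (hdist'.mono hss)
  have hug := hcpt.uniformContinuousOn_of_continuous (hγ.mono hss)
  rw [Metric.uniformContinuousOn_iff] at hud hug
  refine ⟨R, M, hρ, fun t ht => ?_, hne, hsub, hcone, hγ1, hγ,
    fun t ht x hx => hM (t, x) ⟨ht, hx⟩, fun ε hε => ?_, fun ε hε => ?_, fun s hs x hx => ?_⟩
  · have : D t = (fun x => (t, x)) ⁻¹' U := Set.ext (hsec t ht)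
    rw [this]
    exact hUo.preimage (by fun_prop)
  · obtain ⟨δ, hδ, H⟩ := hug ε hε
    refine ⟨δ / 2, by positivity, fun s hs t ht x hx y hy h1 h2 => ?_⟩
    rw [← dist_eq_norm]
    refine (H (s, x) ⟨hs, hx⟩ (t, y) ⟨ht, hy⟩ ?_).le
    rw [Prod.dist_eq, Real.dist_eq]
    exact max_lt (by simp only; linarith) (by simp only; linarith)
  · obtain ⟨δ, hδ, H⟩ := hud ε hε
    refine ⟨δ / 2, by positivity, fun s hs t ht h1 x hx => ?_⟩
    have hxR := closedBall_subset_closedBall (by linarith : R ≤ R + 1) (hsub s hs hx)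
    have := H (s, x) ⟨hs, hxR⟩ (t, x) ⟨ht, hxR⟩ (by
      rw [Prod.dist_eq, Real.dist_eq, dist_self]
      exact max_lt (by simp only; linarith) hδ)
    have h0 : infDist x (D s) = 0 := by
      rw [← infDist_closure]; exact infDist_zero_of_mem hx
    simp only [h0] at this
    rw [Real.dist_eq] at this
    linarith [(abs_lt.1 this).1]
  · obtain ⟨δ, hδ, H⟩ := Metric.isOpen_iff.1 hUo _ ((hsec s hs x).1 hx)
    refine ⟨δ / 2, by positivity, fun t ht h1 y h2 => (hsec t ht y).2 (H ?_)⟩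
    rw [mem_ball, Prod.dist_eq, Real.dist_eq]
    exact max_lt (by simp only; linarith) (by simp only; linarith)

theorem IsAdmissible.exists_isUniformDomain {n : ℕ} {T : ℝ}
    {Ω : Set (ℝ × EuclideanSpace ℝ (Fin n))}
    {γ : ℝ → EuclideanSpace ℝ (Fin n) → EuclideanSpace ℝ (Fin n)}
    (h : IsAdmissible T Ω γ) :
    ∃ R ρ M, IsUniformDomain T R ρ M (timeSection Ω) γ := by
  obtain ⟨U, hUo, -, hUb, hΩ⟩ := h.isTimeDependentDomain.exists_open
  obtain ⟨ρ, hρ, hcone⟩ := h.exterior_cone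
  obtain ⟨R, M, H⟩ := ObliqueSkorohod.exists_isUniformDomain hUo hUb
    (fun t ht x => show (t, x) ∈ Ω ↔ (t, x) ∈ U by simp [hΩ, ht.1, ht.2])
    (fun t ht => (h.isTimeDependentDomain.isConnected_section t ht).nonempty)
    h.isC12.continuousOn h.norm_eq_one hρ.1
    (fun t ht z hz ζ hζ =>
      (subset_biUnion_of_mem (u := fun ζ => closedBall (z - ζ • γ t z) (ζ * ρ)) hζ).trans
        (hcone t ht z hz))
    (fun x => (h.memH1_dist x).continuousOn)
  exact ⟨R, ρ, M, H⟩


/-! ### Construction of the Euler scheme. -/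

section

variable {E : Type*} [NormedAddCommGroup E] [NormedSpace ℝ E] {T R ρ M : ℝ} {D : ℝ → Set E}
  {γ : ℝ → E → E} {ψ : ℝ → E}

theorem exists_modulus_of_continuousOn {F : Type*} [SeminormedAddCommGroup F] {f : ℝ → F}
    (hf : ContinuousOn f (Icc 0 T)) {ε : ℝ} (hε : 0 < ε) :
    ∃ h > 0, ∀ s ∈ Icc 0 T, ∀ t ∈ Icc 0 T, |s - t| ≤ h → ‖f t - f s‖ ≤ ε := by
  have := isCompact_Icc.uniformContinuousOn_of_continuous hf
  obtain ⟨δ, hδ, H⟩ := Metric.uniformContinuousOn_iff.1 this ε hε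
  refine ⟨δ / 2, by positivity, fun s hs t ht h => ?_⟩
  rw [← dist_eq_norm]
  refine (H t ht s hs ?_).le
  rw [dist_comm, Real.dist_eq]
  linarith

theorem exists_pos_le_mul_le {a B c : ℝ} (ha : 0 < a) (hc : 0 < c) (hB : 0 < B) :
    ∃ x > 0, x ≤ a ∧ x * B ≤ c :=
  ⟨min a (c / B), lt_min ha (by positivity), min_le_left _ _,
    (mul_le_mul_of_nonneg_right (min_le_right _ _) hB.le).trans (by field_simp; rfl)⟩

theorem IsUniformDomain.exists_near [ProperSpace E] (h : IsUniformDomain T R ρ M D γ)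
    {ε : ℝ} (hε : 0 < ε) : ∃ m > 0, ∀ s ∈ Icc 0 T, ∀ t ∈ Icc 0 T, |s - t| ≤ m →
      ∀ x ∈ closure (D s), ∃ y ∈ closure (D t), ‖x - y‖ ≤ ε := by
  obtain ⟨m, hm, H⟩ := h.modulus_dist ε hε
  refine ⟨m, hm, fun s hs t ht hst x hx => ?_⟩
  obtain ⟨y, hy, hxy⟩ := isClosed_closure.exists_infDist_eq_dist
    (closure_nonempty_iff.2 (h.nonempty t ht)) x
  refine ⟨y, hy, ?_⟩
  rw [← dist_eq_norm, ← hxy, infDist_closure]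
  exact H s hs t ht hst x hx

theorem IsUniformDomain.norm_le_of_mem (h : IsUniformDomain T R ρ M D γ) {t : ℝ}
    (ht : t ∈ Icc 0 T) {x : E} (hx : x ∈ closure (D t)) : ‖x‖ ≤ R := by
  simpa using h.closure_subset t ht hx

/-- One step of the time discretization: after the increment of `ψ`, the point is pushed back along
`γ`. -/
theorem IsUniformDomain.exists_step [ProperSpace E] (h : IsUniformDomain T R ρ M D γ)
    (hψ : ContinuousOn ψ (Icc 0 T)) {ε : ℝ} (hε : 0 < ε) :
    ∃ m > 0, ∀ s ∈ Icc 0 T, ∀ t ∈ Icc 0 T, |s - t| ≤ m → ∀ x ∈ closure (D s),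
      ∃ (x' : E) (L : ℝ), 0 ≤ L ∧ L ≤ ε ∧ x' ∈ closure (D t) ∧
        ‖x' - x - (ψ t - ψ s) - L • γ t x'‖ ≤ ε * L ∧ (L = 0 ∨ x' ∈ frontier (D t)) := by
  have hρ := h.rho_pos
  obtain ⟨r₀, hr₀, hmod⟩ := h.modulus_direction (min ε (ρ / 2)) (by positivity)
  set r := min r₀ 1
  have hr : 0 < r := by positivity
  have hrr₀ : r ≤ r₀ := min_le_left _ _
  have hr1 : r ≤ 1 := min_le_right _ _
  -- `K` is the largest push allowed: at most `ε`, at most the cone height `ρ`, and short enough to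
  -- stay where `γ` is nearly constant. The deviation `δ = ρ * K / 4` lies below the tolerance `ρ /
  -- 2 * K` of the interior cone.
  obtain ⟨K, hK, hKε, hKB⟩ := exists_pos_le_mul_le (a := min ε ρ) (B := |M| + ρ) (c := r / 4)
    (by positivity) (by positivity) (by positivity)
  set δ := ρ * K / 4 with hδ
  have hδ0 : 0 < δ := by positivity
  obtain ⟨m₁, hm₁, H₁⟩ := exists_modulus_of_continuousOn hψ (half_pos hδ0)
  obtain ⟨m₂, hm₂, H₂⟩ := h.exists_near (half_pos hδ0)
  refine ⟨min m₁ m₂, by positivity, fun s hs t ht hst x hx => ?_⟩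
  obtain ⟨y, hy, hxy⟩ := H₂ s hs t ht (hst.trans (min_le_right _ _)) x hx
  have ha := H₁ s hs t ht (hst.trans (min_le_left _ _))
  set z := x + (ψ t - ψ s) with hz
  have hKM : K * |M| ≤ r / 4 := by nlinarith [mul_pos hK hρ]
  have hKρ : ρ * K ≤ r / 4 := by nlinarith [mul_nonneg hK.le (abs_nonneg M)]
  have hzy : ‖z - y‖ ≤ δ := by
    have : z - y = (x - y) + (ψ t - ψ s) := by rw [hz]; abel
    rw [this]
    exact (norm_add_le _ _).trans (by linarith)
  have hyR := h.norm_le_of_mem ht hy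
  have hzR : z ∈ closedBall (0 : E) (R + 1) := by
    rw [mem_closedBall_zero_iff]
    have : ‖z‖ ≤ ‖y‖ + ‖z - y‖ := by simpa using norm_add_le y (z - y)
    linarith
  have hfR : ∀ t ∈ Icc 0 T, ∀ y ∈ closure (D t), y ∈ closedBall (0 : E) (R + 1) :=
    fun t ht y hy => closedBall_subset_closedBall (by linarith) (h.closure_subset t ht hy)
  set g := γ t z
  have hg : ‖g‖ ≤ |M| := (h.norm_le t ht z hzR).trans (le_abs_self M)
  have hKg : ‖K • g‖ ≤ r / 4 := by
    rw [norm_smul, Real.norm_of_nonneg hK.le]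
    exact (mul_le_mul_of_nonneg_left hg hK.le).trans hKM
  by_cases hzD : z ∈ D t
  · refine ⟨z, 0, le_rfl, hε.le, subset_closure hzD, ?_, Or.inl rfl⟩
    simp [hz]
  -- This point is `z + K • g`. As `z` is outside and it is inside, the push meets the boundary at
  -- some `z + (θ * K) • g`; the direction is frozen at `z`, which costs the error `ε * L`.
  have hp : y + (K • g + (z - y)) ∈ D t := by
    refine add_mem_of_exterior_cone (r := r / 2) (h.cone t ht) hy hK
      (hKε.trans (min_le_right _ _)) ?_ (by positivity) ?_ fun w hw hwy => ?_
    · refine hzy.trans_lt ?_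
      rw [hδ]
      nlinarith [mul_pos hK hρ]
    · exact (norm_add_le _ _).trans (by linarith)
    · refine (hmod t ht t ht w (hfR t ht w (frontier_subset_closure hw)) z hzR
        (by simpa using hr₀.le) ?_).trans (min_le_right _ _)
      have := dist_triangle w y z
      rw [dist_comm y z, dist_eq_norm z y] at this
      linarith
  obtain ⟨x', hx', hx'f⟩ := exists_mem_segment_frontier hzD hp
  rw [segment_eq_image'] at hx'
  obtain ⟨θ, hθ, rfl⟩ := hx'
  have e : z + θ • (y + (K • g + (z - y)) - z) = z + (θ * K) • g := by module
  simp only [e] at hx'f ⊢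
  have hθK : θ * K ≤ K := mul_le_of_le_one_left hK.le hθ.2
  refine ⟨z + (θ * K) • g, θ * K, mul_nonneg hθ.1 hK.le,
    hθK.trans (hKε.trans (min_le_left _ _)), frontier_subset_closure hx'f, ?_, Or.inr hx'f⟩
  have e2 : z + (θ * K) • g - x - (ψ t - ψ s) - (θ * K) • γ t (z + (θ * K) • g)
      = (θ * K) • (g - γ t (z + (θ * K) • g)) := by rw [hz]; module
  rw [e2, norm_smul, Real.norm_of_nonneg (mul_nonneg hθ.1 hK.le), mul_comm]
  refine mul_le_mul_of_nonneg_right ?_ (mul_nonneg hθ.1 hK.le)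
  refine (hmod t ht t ht z hzR _ (hfR t ht _ (frontier_subset_closure hx'f))
        (by simpa using hr₀.le) ?_).trans (min_le_left _ _)
  rw [dist_eq_norm, sub_add_cancel_left, norm_neg, mul_smul, norm_smul, Real.norm_of_nonneg hθ.1]
  have := mul_le_of_le_one_left (norm_nonneg (K • g)) hθ.2
  linarith

/-- An Euler scheme of precision `ε` on the grid `k * τ`, `k ≤ N`, for the Skorohod problem; `L k`
is the length of the push in the `k`-th step. -/
structure IsScheme (T : ℝ) (D : ℝ → Set E) (γ : ℝ → E → E) (ψ : ℝ → E) (ε τ : ℝ) (N : ℕ)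
    (x : ℕ → E) (L : ℕ → ℝ) : Prop where
  mesh_pos : 0 < τ
  mesh_le : τ ≤ ε
  mul_mesh : N * τ = T
  zero : x 0 = ψ 0
  mem : ∀ k ≤ N, x k ∈ closure (D (k * τ))
  nonneg : ∀ k < N, 0 ≤ L k
  le : ∀ k < N, L k ≤ ε
  step : ∀ k < N, ‖x (k + 1) - x k - (ψ ((k + 1 : ℕ) * τ) - ψ (k * τ))
    - L k • γ ((k + 1 : ℕ) * τ) (x (k + 1))‖ ≤ ε * L k
  frontier : ∀ k < N, L k = 0 ∨ x (k + 1) ∈ frontier (D ((k + 1 : ℕ) * τ))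

theorem IsScheme.time_mem {ε τ : ℝ} {N : ℕ} {x : ℕ → E} {L : ℕ → ℝ}
    (hs : IsScheme T D γ ψ ε τ N x L) {k : ℕ} (hk : k ≤ N) : (k : ℝ) * τ ∈ Icc 0 T := by
  refine ⟨mul_nonneg (Nat.cast_nonneg k) hs.mesh_pos.le, ?_⟩
  rw [← hs.mul_mesh]
  exact mul_le_mul_of_nonneg_right (Nat.cast_le.2 hk) hs.mesh_pos.le

theorem IsUniformDomain.exists_isScheme [ProperSpace E] (h : IsUniformDomain T R ρ M D γ)
    (hT : 0 < T) (hψ : ContinuousOn ψ (Icc 0 T)) (hψ0 : ψ 0 ∈ closure (D 0)) {ε : ℝ}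
    (hε : 0 < ε) : ∃ τ N x L, IsScheme T D γ ψ ε τ N x L := by
  obtain ⟨m, hm, H⟩ := h.exists_step hψ hε
  obtain ⟨N', hN'⟩ := exists_nat_gt (T / min m ε)
  have hN'0 : (0 : ℝ) < N' := lt_trans (by positivity) hN'
  set τ := T / N' with hτ
  have hτ0 : 0 < τ := by positivity
  have hNτ : (N' : ℝ) * τ = T := by rw [hτ]; field_simp
  have hτm : τ ≤ min m ε := by
    rw [hτ, div_le_iff₀ hN'0]
    rw [div_lt_iff₀ (by positivity)] at hN'
    linarith
  have htm : ∀ k ≤ N', (k : ℝ) * τ ∈ Icc 0 T := fun k hk => by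
    refine ⟨by positivity, ?_⟩
    rw [← hNτ]
    exact mul_le_mul_of_nonneg_right (Nat.cast_le.2 hk) hτ0.le
  -- The hypotheses stand under the existential so that `choose` returns a total function, usable in
  -- the recursion; the default value `0` is never met along the scheme.
  have key : ∀ (k : ℕ) (x : E), ∃ p : E × ℝ, k < N' → x ∈ closure (D (k * τ)) →
      0 ≤ p.2 ∧ p.2 ≤ ε ∧ p.1 ∈ closure (D ((k + 1 : ℕ) * τ)) ∧
        ‖p.1 - x - (ψ ((k + 1 : ℕ) * τ) - ψ (k * τ)) - p.2 • γ ((k + 1 : ℕ) * τ) p.1‖ ≤ ε * p.2 ∧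
        (p.2 = 0 ∨ p.1 ∈ frontier (D ((k + 1 : ℕ) * τ))) := by
    intro k x
    by_cases hk : k < N' ∧ x ∈ closure (D (k * τ))
    · obtain ⟨x', L, hx'⟩ := H (k * τ) (htm k hk.1.le) ((k + 1 : ℕ) * τ) (htm _ hk.1) (by
        have : (k : ℝ) * τ - (k + 1 : ℕ) * τ = -τ := by push_cast; ring
        rw [this, abs_neg, abs_of_pos hτ0]
        exact hτm.trans (min_le_left _ _)) x hk.2
      exact ⟨(x', L), fun _ _ => hx'⟩
    · exact ⟨0, fun h1 h2 => (hk ⟨h1, h2⟩).elim⟩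
  choose F hF using key
  let x : ℕ → E := fun n => Nat.rec (ψ 0) (fun k y => (F k y).1) n
  have hmem : ∀ k ≤ N', x k ∈ closure (D (k * τ)) := by
    intro k
    induction k with
    | zero =>
      intro _
      change ψ 0 ∈ _
      simpa using hψ0
    | succ k ih => exact fun hk => (hF k (x k) hk (ih (Nat.le_of_succ_le hk))).2.2.1
  exact ⟨τ, N', x, fun k => (F k (x k)).2, hτ0, hτm.trans (min_le_right _ _), hNτ, rfl, hmem,
    fun k hk => (hF k (x k) hk (hmem k hk.le)).1,
    fun k hk => (hF k (x k) hk (hmem k hk.le)).2.1,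
    fun k hk => (hF k (x k) hk (hmem k hk.le)).2.2.2.1,
    fun k hk => (hF k (x k) hk (hmem k hk.le)).2.2.2.2⟩

end

/-! ### Estimates for the scheme, uniform in the mesh. -/

section

variable {E : Type*} [NormedAddCommGroup E] [NormedSpace ℝ E] {T R ρ M : ℝ} {D : ℝ → Set E}
  {γ : ℝ → E → E} {ψ : ℝ → E} {ε τ : ℝ} {N : ℕ} {x : ℕ → E} {L : ℕ → ℝ}

/-- The accumulated length of the pushes of a scheme. -/
def pushLength (L : ℕ → ℝ) (k : ℕ) : ℝ := ∑ i ∈ Finset.range k, L i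

/-- The accumulated push of a scheme. -/
def pushVector {E : Type*} [AddCommGroup E] (ψ : ℝ → E) (τ : ℝ) (x : ℕ → E) (k : ℕ) : E := x k - ψ (k * τ)

theorem pushLength_succ (L : ℕ → ℝ) (k : ℕ) : pushLength L (k + 1) = pushLength L k + L k :=
  Finset.sum_range_succ _ _

theorem IsScheme.pushLength_mono (hs : IsScheme T D γ ψ ε τ N x L) {j k : ℕ} (hjk : j ≤ k)
    (hk : k ≤ N) : pushLength L j ≤ pushLength L k := by
  induction k, hjk using Nat.le_induction with
  | base => rfl
  | succ k _ ih =>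
    rw [pushLength_succ]
    linarith [ih (Nat.le_of_succ_le hk), hs.nonneg k hk]

theorem IsScheme.norm_step_sub_le (hs : IsScheme T D γ ψ ε τ N x L) {k : ℕ} (hk : k < N) (g : E) :
    ‖pushVector ψ τ x (k + 1) - pushVector ψ τ x k - L k • g‖
      ≤ (ε + ‖γ ((k + 1 : ℕ) * τ) (x (k + 1)) - g‖) * L k := by
  have e : pushVector ψ τ x (k + 1) - pushVector ψ τ x k - L k • g
      = (x (k + 1) - x k - (ψ ((k + 1 : ℕ) * τ) - ψ (k * τ))
        - L k • γ ((k + 1 : ℕ) * τ) (x (k + 1)))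
        + L k • (γ ((k + 1 : ℕ) * τ) (x (k + 1)) - g) := by
    simp only [pushVector]
    module
  rw [e, add_mul]
  refine (norm_add_le _ _).trans (add_le_add (hs.step k hk) ?_)
  rw [norm_smul, Real.norm_of_nonneg (hs.nonneg k hk), mul_comm]

/-- If each step adds at most `c` times its length, so does a run of steps. -/
theorem IsScheme.norm_sub_le_of_step (hs : IsScheme T D γ ψ ε τ N x L) {c : ℝ} {g : E} {j k : ℕ}
    (hjk : j ≤ k) (hk : k ≤ N)
    (hstep : ∀ i, j ≤ i → i < k → L i ≠ 0 → ε + ‖γ ((i + 1 : ℕ) * τ) (x (i + 1)) - g‖ ≤ c) :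
    ‖pushVector ψ τ x k - pushVector ψ τ x j - (pushLength L k - pushLength L j) • g‖
      ≤ c * (pushLength L k - pushLength L j) := by
  induction k, hjk using Nat.le_induction with
  | base => simp
  | succ k hjk ih =>
    have ih := ih (Nat.le_of_succ_le hk) (fun i h1 h2 => hstep i h1 (Nat.lt_succ_of_lt h2))
    have h1 := hs.norm_step_sub_le hk g
    have h2 : (ε + ‖γ ((k + 1 : ℕ) * τ) (x (k + 1)) - g‖) * L k ≤ c * L k := by
      by_cases h0 : L k = 0
      · simp [h0]
      · exact mul_le_mul_of_nonneg_right (hstep k hjk k.lt_succ_self h0) (hs.nonneg k hk)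
    have e : pushVector ψ τ x (k + 1) - pushVector ψ τ x j
        - (pushLength L (k + 1) - pushLength L j) • g
        = (pushVector ψ τ x k - pushVector ψ τ x j - (pushLength L k - pushLength L j) • g)
          + (pushVector ψ τ x (k + 1) - pushVector ψ τ x k - L k • g) := by
      rw [pushLength_succ]
      module
    rw [e]
    refine (norm_add_le _ _).trans ?_
    rw [pushLength_succ]
    linarith

theorem IsScheme.time_sub_le (hs : IsScheme T D γ ψ ε τ N x L) {i j k : ℕ} (hji : j ≤ i)
    (hik : i ≤ k) {h₀ : ℝ} (hh : ((k : ℝ) - j) * τ ≤ h₀) : |(j : ℝ) * τ - i * τ| ≤ h₀ := by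
  have h1 : (j : ℝ) ≤ i := Nat.cast_le.2 hji
  have h2 : (i : ℝ) ≤ k := Nat.cast_le.2 hik
  rw [← sub_mul, abs_mul, abs_of_pos hs.mesh_pos, abs_of_nonpos (by linarith)]
  exact (mul_le_mul_of_nonneg_right (by linarith) hs.mesh_pos.le).trans hh

theorem IsUniformDomain.mem_ball (h : IsUniformDomain T R ρ M D γ) {t : ℝ} (ht : t ∈ Icc 0 T)
    {y : E} (hy : y ∈ closure (D t)) : y ∈ closedBall (0 : E) (R + 1) :=
  closedBall_subset_closedBall (by linarith) (h.closure_subset t ht hy)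

theorem IsUniformDomain.norm_pushVector_le (h : IsUniformDomain T R ρ M D γ)
    (hs : IsScheme T D γ ψ ε τ N x L) {j k : ℕ} (hjk : j ≤ k) (hk : k ≤ N) :
    ‖pushVector ψ τ x k - pushVector ψ τ x j‖ ≤ (ε + |M|) * (pushLength L k - pushLength L j) := by
  -- Comparison with the zero direction gives the crude bound.
  have := hs.norm_sub_le_of_step (g := 0) (c := ε + |M|) hjk hk (fun i _ hi _ => by
    have ht := hs.time_mem (k := i + 1) (by omega)
    have := (h.norm_le _ ht _ (h.mem_ball ht (hs.mem (i + 1) (by omega)))).trans (le_abs_self M)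
    simpa using this)
  simpa using this

theorem node_sub_eq {E : Type*} [AddCommGroup E] (ψ : ℝ → E) (τ : ℝ) (x : ℕ → E) (k j : ℕ) : x k - x j
    = (ψ (k * τ) - ψ (j * τ)) + (pushVector ψ τ x k - pushVector ψ τ x j) := by
  simp only [pushVector]
  abel

/-- The pushes accumulated by a scheme over short time intervals are uniformly small. -/
theorem IsUniformDomain.exists_pushLength_le [ProperSpace E] (h : IsUniformDomain T R ρ M D γ)
    (hψ : ContinuousOn ψ (Icc 0 T)) {η : ℝ} (hη : 0 < η) :
    ∃ h₀ > 0, ∃ ε₀ > 0, ∀ (ε τ : ℝ) (N : ℕ) (x : ℕ → E) (L : ℕ → ℝ),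
      IsScheme T D γ ψ ε τ N x L → ε ≤ ε₀ → ∀ j k, j ≤ k → k ≤ N → ((k : ℝ) - j) * τ ≤ h₀ →
        pushLength L k - pushLength L j ≤ η := by
  have hρ := h.rho_pos
  obtain ⟨r, hr, hmod⟩ := h.modulus_direction (ρ / 8) (by positivity)
  -- One further step may raise the total from `a` to `2 * a`: hence `a ≤ ρ / 2`, keeping `2 * a`
  -- within the cone height, and the factors 2 in `B`, keeping the displacement where `γ` is nearly
  -- constant.
  obtain ⟨a, ha, hamin, haB⟩ := exists_pos_le_mul_le (a := min (min 1 η) (ρ / 2))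
    (B := 2 * |M| + 2 * ρ + 1) (c := r / 4) (by positivity) (by positivity) (by positivity)
  have ha1 : a ≤ 1 := hamin.trans ((min_le_left _ _).trans (min_le_left _ _))
  have haη : a ≤ η := hamin.trans ((min_le_left _ _).trans (min_le_right _ _))
  have haρ : a ≤ ρ / 2 := hamin.trans (min_le_right _ _)
  set δ := ρ * a / 8 with hδ
  have hδ0 : 0 < δ := by positivity
  obtain ⟨m₁, hm₁, H₁⟩ := exists_modulus_of_continuousOn hψ hδ0
  obtain ⟨m₂, hm₂, H₂⟩ := h.exists_near hδ0
  refine ⟨min (min m₁ m₂) r, by positivity, min a (ρ / 8), by positivity,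
    fun ε τ N x L hs hε j k hjk hk hh => ?_⟩
  have hεa : ε ≤ a := hε.trans (min_le_left _ _)
  have hερ : ε ≤ ρ / 8 := hε.trans (min_le_right _ _)
  have hε0 : 0 < ε := hs.mesh_pos.trans_le hs.mesh_le
  set g := γ (j * τ) (x j)
  have htj := hs.time_mem (hjk.trans hk)
  have hxj := hs.mem j (hjk.trans hk)
  -- Length and direction are bounded together: the direction estimate for the next step needs the
  -- node to be near `x j`, which needs the length bound up to `k`.
  suffices hmain : pushLength L k - pushLength L j ≤ a ∧
      ‖pushVector ψ τ x k - pushVector ψ τ x j - (pushLength L k - pushLength L j) • g‖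
        ≤ ρ / 4 * (pushLength L k - pushLength L j) from hmain.1.trans haη
  induction k, hjk using Nat.le_induction with
  | base => simp [ha.le]
  | succ k hjk ih =>
    have hkN : k < N := hk
    have hjk1 : j ≤ k + 1 := hjk.trans k.le_succ
    have ht := hs.time_mem hk
    have hdt := hs.time_sub_le hjk1 le_rfl hh
    obtain ⟨ih1, ih2⟩ := ih hkN.le (by
      refine le_trans (mul_le_mul_of_nonneg_right ?_ hs.mesh_pos.le) hh
      push_cast
      linarith)
    by_cases h0 : L k = 0
    · have h1 := hs.norm_step_sub_le hkN g
      rw [h0] at h1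
      simp only [zero_smul, sub_zero, mul_zero, norm_le_zero_iff, sub_eq_zero] at h1
      rw [pushLength_succ, h0, add_zero, h1]
      exact ⟨ih1, ih2⟩
    have hf := (hs.frontier k hkN).resolve_left h0
    have hLk := hs.nonneg k hkN
    have hLε := hs.le k hkN
    have hψk : ‖ψ ((k + 1 : ℕ) * τ) - ψ (j * τ)‖ ≤ δ :=
      H₁ _ htj _ ht (hdt.trans ((min_le_left _ _).trans (min_le_left _ _)))
    set A := pushLength L (k + 1) - pushLength L j with hA
    have hA' : A = (pushLength L k - pushLength L j) + L k := by rw [hA, pushLength_succ]; ring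
    have hAle : A ≤ 2 * a := by linarith
    have hA0 : 0 ≤ A := sub_nonneg.2 (hs.pushLength_mono hjk1 hk)
    have hδr : δ ≤ r / 4 := by nlinarith [mul_pos hρ ha, mul_nonneg ha.le (abs_nonneg M)]
    have hxx : dist (x (k + 1)) (x j) ≤ r / 2 := by
      rw [dist_eq_norm, node_sub_eq ψ τ]
      have h1 := h.norm_pushVector_le hs hjk1 hk
      rw [← hA] at h1
      have h2 : (ε + |M|) * A ≤ (ρ + |M|) * (2 * a) := by
        gcongr
        linarith
      have h3 := norm_add_le (ψ ((k + 1 : ℕ) * τ) - ψ (j * τ))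
        (pushVector ψ τ x (k + 1) - pushVector ψ τ x j)
      linarith
    have hvec : ‖pushVector ψ τ x (k + 1) - pushVector ψ τ x j - A • g‖ ≤ ρ / 4 * A := by
      have h1 := hs.norm_step_sub_le hkN g
      have h2 : ‖γ ((k + 1 : ℕ) * τ) (x (k + 1)) - g‖ ≤ ρ / 8 :=
        hmod _ ht _ htj _ (h.mem_ball ht (hs.mem _ hk)) _ (h.mem_ball htj hxj)
          (by rw [abs_sub_comm]; exact hdt.trans (min_le_right _ _)) (by linarith)
      have e : pushVector ψ τ x (k + 1) - pushVector ψ τ x j - A • g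
          = (pushVector ψ τ x k - pushVector ψ τ x j - (pushLength L k - pushLength L j) • g)
            + (pushVector ψ τ x (k + 1) - pushVector ψ τ x k - L k • g) := by
        rw [hA']
        module
      rw [e]
      refine (norm_add_le _ _).trans ?_
      have h3 : (ε + ‖γ ((k + 1 : ℕ) * τ) (x (k + 1)) - g‖) * L k ≤ ρ / 4 * L k :=
        mul_le_mul_of_nonneg_right (by linarith) hLk
      rw [hA', mul_add]
      linarith
    refine ⟨?_, hvec⟩
    -- The errors of `ψ`, of the domain and of the direction sum to at most `ρ * a / 4 + ρ * A / 4`,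
    -- which is below `ρ / 2 * A` as soon as `a < A`; the interior cone then contradicts `hf`.
    by_contra! hlt
    obtain ⟨y, hy, hxy⟩ := H₂ _ htj _ ht
      (hdt.trans ((min_le_left _ _).trans (min_le_right _ _))) (x j) hxj
    have hnot : x (k + 1) ∉ D ((k + 1 : ℕ) * τ) := fun hin =>
      (h.isOpen _ ht).inter_frontier_eq.subset ⟨hin, hf⟩
    refine hnot ?_
    have e : x (k + 1) = y + (A • g + (x (k + 1) - y - A • g)) := by abel
    rw [e]
    have hxky : ‖x (k + 1) - y‖ ≤ r / 2 + δ := by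
      have : x (k + 1) - y = (x (k + 1) - x j) + (x j - y) := by abel
      rw [this]
      rw [dist_eq_norm] at hxx
      exact (norm_add_le _ _).trans (by linarith)
    refine add_mem_of_exterior_cone (r := r / 2 + δ) (h.cone _ ht) hy (by linarith) (by linarith)
      ?_ (by positivity) ?_ fun w hw hwy => ?_
    · have e2 : x (k + 1) - y - A • g = (ψ ((k + 1 : ℕ) * τ) - ψ (j * τ)) + (x j - y)
          + (pushVector ψ τ x (k + 1) - pushVector ψ τ x j - A • g) := by
        simp only [pushVector]
        abel
      rw [e2]
      have h1 := norm_add_le ((ψ ((k + 1 : ℕ) * τ) - ψ (j * τ)) + (x j - y))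
        (pushVector ψ τ x (k + 1) - pushVector ψ τ x j - A • g)
      have h2 := norm_add_le (ψ ((k + 1 : ℕ) * τ) - ψ (j * τ)) (x j - y)
      nlinarith [mul_lt_mul_of_pos_left hlt hρ]
    · rwa [add_sub_cancel]
    · refine (hmod _ ht _ htj w (h.mem_ball ht (frontier_subset_closure hw)) _
        (h.mem_ball htj hxj) (by rw [abs_sub_comm]; exact hdt.trans (min_le_right _ _)) ?_).trans
        (by linarith)
      have := dist_triangle w y (x j)
      rw [dist_comm y, dist_eq_norm (x j)] at this
      linarith

/-- Local behaviour of the schemes, uniformly in the precision. -/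
theorem IsUniformDomain.exists_scheme_estimate [ProperSpace E] (h : IsUniformDomain T R ρ M D γ)
    (hψ : ContinuousOn ψ (Icc 0 T)) {η : ℝ} (hη : 0 < η) :
    ∃ h₀ > 0, ∃ ε₀ > 0, ∀ (ε τ : ℝ) (N : ℕ) (x : ℕ → E) (L : ℕ → ℝ),
      IsScheme T D γ ψ ε τ N x L → ε ≤ ε₀ → ∀ j k, j ≤ k → k ≤ N → ((k : ℝ) - j) * τ ≤ h₀ →
        pushLength L k - pushLength L j ≤ η ∧ ‖x k - x j‖ ≤ η ∧
        ‖pushVector ψ τ x k - pushVector ψ τ x j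
          - (pushLength L k - pushLength L j) • γ (j * τ) (x j)‖
            ≤ η * (pushLength L k - pushLength L j) ∧
        |‖γ (j * τ) (x j)‖ - 1| * (pushLength L k - pushLength L j)
          ≤ η * (pushLength L k - pushLength L j) := by
  obtain ⟨r, hr, hmod⟩ := h.modulus_direction (η / 2) (by positivity)
  obtain ⟨a, ha, haη, haB⟩ := exists_pos_le_mul_le (a := η) (B := 1 + |M|) (c := min η r / 2)
    hη (by positivity) (by positivity)
  obtain ⟨m₁, hm₁, H₁⟩ := exists_modulus_of_continuousOn (ε := min η r / 2) hψ (by positivity)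
  obtain ⟨m₂, hm₂, ε₂, hε₂, H₂⟩ := h.exists_pushLength_le hψ ha
  refine ⟨min (min m₁ m₂) r, by positivity, min ε₂ (min 1 (η / 2)), by positivity,
    fun ε τ N x L hs hε j k hjk hk hh => ?_⟩
  have hε1 : ε ≤ 1 := hε.trans ((min_le_right _ _).trans (min_le_left _ _))
  have hεη : ε ≤ η / 2 := hε.trans ((min_le_right _ _).trans (min_le_right _ _))
  have htj := hs.time_mem (hjk.trans hk)
  have hxj := hs.mem j (hjk.trans hk)
  have hx : ∀ i, j ≤ i → i ≤ k → pushLength L i - pushLength L j ≤ a ∧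
      ‖x i - x j‖ ≤ min η r := by
    intro i hji hik
    have hdt := hs.time_sub_le hji hik hh
    have hA : pushLength L i - pushLength L j ≤ a :=
      H₂ ε τ N x L hs (hε.trans (min_le_left _ _)) j i hji (hik.trans hk)
        (le_trans (mul_le_mul_of_nonneg_right (sub_le_sub_right (Nat.cast_le.2 hik) _)
          hs.mesh_pos.le) (hh.trans ((min_le_left _ _).trans (min_le_right _ _))))
    refine ⟨hA, ?_⟩
    rw [node_sub_eq ψ τ]
    refine (norm_add_le _ _).trans ?_
    have h1 := H₁ _ htj _ (hs.time_mem (hik.trans hk))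
      (hdt.trans ((min_le_left _ _).trans (min_le_left _ _)))
    have h2 := h.norm_pushVector_le hs hji (hik.trans hk)
    have h3 : (ε + |M|) * (pushLength L i - pushLength L j) ≤ (1 + |M|) * a := by
      gcongr
      exact sub_nonneg.2 (hs.pushLength_mono hji (hik.trans hk))
    linarith
  have hdir : ∀ i, j ≤ i → i ≤ k → ‖γ (i * τ) (x i) - γ (j * τ) (x j)‖ ≤ η / 2 := by
    intro i hji hik
    have hti := hs.time_mem (hik.trans hk)
    refine hmod _ hti _ htj _ (h.mem_ball hti (hs.mem _ (hik.trans hk))) _ (h.mem_ball htj hxj) ?_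
      ?_
    · rw [abs_sub_comm]
      exact (hs.time_sub_le hji hik hh).trans (min_le_right _ _)
    · rw [dist_eq_norm]
      exact (hx i hji hik).2.trans (min_le_right _ _)
  refine ⟨(hx k hjk le_rfl).1.trans haη, (hx k hjk le_rfl).2.trans (min_le_left _ _),
    hs.norm_sub_le_of_step hjk hk fun i hji hik _ => ?_, ?_⟩
  · linarith [hdir (i + 1) (by omega) hik]
  -- `hh` would enter the induction hypothesis; all that is needed of it is in `hx` and `hdir`.
  · clear hh
    induction k, hjk using Nat.le_induction with
    | base => simp
    | succ k hjk ih =>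
      have ih := ih (Nat.le_of_succ_le hk) (fun i h1 h2 => hx i h1 (h2.trans k.le_succ))
        (fun i h1 h2 => hdir i h1 (h2.trans k.le_succ))
      -- `γ` has unit length only on the boundary, but a nonzero push ends there, close to `x j`;
      -- this is why the estimate carries the factor of length.
      have hL : |‖γ (j * τ) (x j)‖ - 1| * L k ≤ η * L k := by
        rcases hs.frontier k hk with h0 | hf
        · simp [h0]
        · refine mul_le_mul_of_nonneg_right ?_ (hs.nonneg k hk)
          rw [← h.norm_eq_one _ (hs.time_mem hk) _ hf, abs_sub_comm]
          exact (abs_norm_sub_norm_le _ _).trans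
            ((hdir (k + 1) (by omega) le_rfl).trans (by linarith))
      rw [pushLength_succ]
      linarith

/-- A nonzero push would end on the frontier, which is disjoint from the open domain. -/
theorem IsScheme.pushLength_eq (hs : IsScheme T D γ ψ ε τ N x L)
    (hD : ∀ t ∈ Icc 0 T, IsOpen (D t)) {j k : ℕ} (hjk : j ≤ k) (hk : k ≤ N)
    (hx : ∀ i, j ≤ i → i ≤ k → x i ∈ D (i * τ)) : pushLength L k = pushLength L j := by
  induction k, hjk using Nat.le_induction with
  | base => rfl
  | succ k hjk ih =>
    rw [pushLength_succ, ih (Nat.le_of_succ_le hk) (fun i h1 h2 => hx i h1 (h2.trans k.le_succ)),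
      (hs.frontier k hk).resolve_right fun hf =>
        (hD _ (hs.time_mem hk)).inter_frontier_eq.subset ⟨hx (k + 1) (by omega) le_rfl, hf⟩,
      add_zero]

end

/-! ### Passage to the limit. -/

section

variable {E : Type*} [NormedAddCommGroup E] [NormedSpace ℝ E] {T R ρ M : ℝ} {D : ℝ → Set E}
  {γ : ℝ → E → E} {ψ : ℝ → E} {ε τ : ℝ} {N : ℕ} {x : ℕ → E} {L : ℕ → ℝ}

theorem floor_div_mul_le (hτ : 0 < τ) {t : ℝ} (ht : 0 ≤ t) : (⌊t / τ⌋₊ : ℝ) * τ ≤ t := by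
  have := Nat.floor_le (div_nonneg ht hτ.le)
  rwa [le_div_iff₀ hτ] at this

theorem lt_floor_div_mul_add (hτ : 0 < τ) (t : ℝ) : t < (⌊t / τ⌋₊ : ℝ) * τ + τ := by
  have := Nat.lt_floor_add_one (t / τ)
  rw [div_lt_iff₀ hτ] at this
  linarith

theorem IsScheme.floor_le (hs : IsScheme T D γ ψ ε τ N x L) {t : ℝ} (ht : t ∈ Icc 0 T) :
    ⌊t / τ⌋₊ ≤ N := by
  refine Nat.floor_le_of_le ?_
  rw [div_le_iff₀ hs.mesh_pos, hs.mul_mesh]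
  exact ht.2

theorem IsScheme.pushLength_nonneg (hs : IsScheme T D γ ψ ε τ N x L) {k : ℕ} (hk : k ≤ N) :
    0 ≤ pushLength L k := by
  simpa [pushLength] using hs.pushLength_mono (Nat.zero_le k) hk

/-- If the pushes over time intervals of length `h₀` have total length at most `1`, the total length
grows at most linearly. -/
theorem IsScheme.pushLength_le (hs : IsScheme T D γ ψ ε τ N x L) {h₀ : ℝ} (hτ : τ ≤ h₀ / 2)
    (hle : ∀ j k, j ≤ k → k ≤ N → ((k : ℝ) - j) * τ ≤ h₀ → pushLength L k - pushLength L j ≤ 1)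
    (n : ℕ) : ∀ k ≤ N, k * τ ≤ n * (h₀ / 2) → pushLength L k ≤ n := by
  have hτ0 := hs.mesh_pos
  induction n with
  | zero =>
    intro k _ hkt
    have : (k : ℝ) ≤ 0 := by
      by_contra! h0
      have := mul_pos h0 hτ0
      simp only [Nat.cast_zero, zero_mul] at hkt
      linarith
    have : k = 0 := by exact_mod_cast le_antisymm this (Nat.cast_nonneg k)
    simp [this, pushLength]
  | succ n ih =>
    intro k hk hkt
    push_cast at hkt ⊢
    by_cases hkn : k * τ ≤ n * (h₀ / 2)
    · linarith [ih k hk hkn]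
    have h1 : (0 : ℝ) ≤ n * (h₀ / 2) := mul_nonneg (Nat.cast_nonneg n) (by linarith)
    have h2 := floor_div_mul_le hτ0 h1
    have h3 := lt_floor_div_mul_add hτ0 (n * (h₀ / 2))
    -- The last node before `n * (h₀ / 2)` precedes `k * τ` by at most `h₀ / 2 + τ ≤ h₀`.
    set j := ⌊n * (h₀ / 2) / τ⌋₊
    have hjk : j ≤ k := by
      have : (j : ℝ) * τ < k * τ := by linarith
      exact_mod_cast (lt_of_mul_lt_mul_right this hτ0.le).le
    have h4 := hle j k hjk hk (by rw [sub_mul]; linarith)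
    linarith [ih j (hjk.trans hk) h2]

/-- A single ultrafilter gives limits at all times at once, without extracting subsequences. -/
theorem exists_tendsto_ultrafilter_of_norm_le {F : Type*} [SeminormedAddCommGroup F] [ProperSpace F]
    {ι : Type*} (U : Ultrafilter ι) {u : ι → F} {C : ℝ} (hu : ∀ᶠ i in (U : Filter ι), ‖u i‖ ≤ C) :
    ∃ a, Tendsto u U (𝓝 a) := by
  obtain ⟨a, -, ha⟩ := (isCompact_closedBall (0 : F) C).ultrafilter_le_nhds' (U.map u)
    (mem_map.2 (hu.mono fun i hi => mem_closedBall_zero_iff.2 hi))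
  exact ⟨a, ha⟩

/-- The limit of the Euler schemes: a push `l` with a length function `v`, on an infinitesimal
level. -/
structure IsLimitPush (T : ℝ) (D : ℝ → Set E) (γ : ℝ → E → E) (ψ l : ℝ → E) (v : ℝ → ℝ) :
    Prop where
  zero_vector : l 0 = 0
  zero_length : v 0 = 0
  mem_closure : ∀ t ∈ Icc 0 T, ψ t + l t ∈ closure (D t)
  estimate : ∀ η > 0, ∃ h > 0, ∀ s ∈ Icc 0 T, ∀ t ∈ Icc 0 T, s ≤ t → t ≤ s + h →
    0 ≤ v t - v s ∧ v t - v s ≤ η ∧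
      ‖l t - l s - (v t - v s) • γ s (ψ s + l s)‖ ≤ η * (v t - v s) ∧
      |‖γ s (ψ s + l s)‖ - 1| * (v t - v s) ≤ η * (v t - v s)
  constant : ∀ s ∈ Icc 0 T, ψ s + l s ∈ D s → ∃ h > 0, ∀ t ∈ Icc 0 T, |t - s| ≤ h → v t = v s

theorem IsUniformDomain.exists_isLimitPush [ProperSpace E] (h : IsUniformDomain T R ρ M D γ)
    (hT : 0 < T) (hψ : ContinuousOn ψ (Icc 0 T)) (hψ0 : ψ 0 ∈ closure (D 0)) :
    ∃ l v, IsLimitPush T D γ ψ l v := by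
  have hex := fun m : ℕ => h.exists_isScheme hT hψ hψ0 (Nat.one_div_pos_of_nat (α := ℝ) (n := m))
  choose τ N x L hs using hex
  set U : Ultrafilter ℕ := hyperfilter ℕ
  have hsmall : ∀ c > 0, ∀ᶠ m : ℕ in (U : Filter ℕ), 1 / ((m : ℝ) + 1) ≤ c := fun c hc =>
    Nat.hyperfilter_le_atTop
      (((tendsto_order.1 tendsto_one_div_add_atTop_nhds_zero_nat).2 c hc).mono fun m hm => hm.le)
  have hτ0 : ∀ m, 0 < τ m := fun m => (hs m).mesh_pos
  have hτs : ∀ c > 0, ∀ᶠ m in (U : Filter ℕ), τ m ≤ c := fun c hc =>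
    (hsmall c hc).mono fun m hm => (hs m).mesh_le.trans hm
  -- `κ m t` is the index of the last node before `t`: the schemes are interpolated by step
  -- functions.
  set κ : ℕ → ℝ → ℕ := fun m t => ⌊t / τ m⌋₊ with hκ
  have hκN : ∀ m, ∀ t ∈ Icc 0 T, κ m t ≤ N m := fun m t ht => (hs m).floor_le ht
  have hκ1 : ∀ m, ∀ t ∈ Icc 0 T, (κ m t : ℝ) * τ m ≤ t := fun m t ht =>
    floor_div_mul_le (hτ0 m) ht.1
  have hκ2 : ∀ m t, t < (κ m t : ℝ) * τ m + τ m := fun m t => lt_floor_div_mul_add (hτ0 m) t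
  have hκmem : ∀ m, ∀ t ∈ Icc 0 T, (κ m t : ℝ) * τ m ∈ Icc 0 T := fun m t ht =>
    (hs m).time_mem (hκN m t ht)
  have hκmono : ∀ m s t, s ≤ t → κ m s ≤ κ m t := fun m s t hst =>
    Nat.floor_le_floor (div_le_div_of_nonneg_right hst (hτ0 m).le)
  have hκlim : ∀ t ∈ Icc 0 T, Tendsto (fun m => (κ m t : ℝ) * τ m) U (𝓝 t) := fun t ht => by
    rw [Metric.tendsto_nhds]
    intro c hc
    filter_upwards [hτs c hc] with m hm
    rw [Real.dist_eq, abs_lt]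
    constructor <;> linarith [hκ1 m t ht, hκ2 m t]
  have hψlim : ∀ t ∈ Icc 0 T, Tendsto (fun m => ψ (κ m t * τ m)) U (𝓝 (ψ t)) := fun t ht =>
    (hψ t ht).tendsto.comp (tendsto_nhdsWithin_iff.2
      ⟨hκlim t ht, Eventually.of_forall fun m => hκmem m t ht⟩)
  have hvex : ∀ t, ∃ a, t ∈ Icc 0 T → Tendsto (fun m => pushLength (L m) (κ m t)) U (𝓝 a) := by
    intro t
    by_cases ht : t ∈ Icc 0 T
    swap
    · exact ⟨0, fun h0 => (ht h0).elim⟩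
    obtain ⟨h₀, hh₀, ε₀, hε₀, H⟩ := h.exists_pushLength_le hψ one_pos
    obtain ⟨n, hn⟩ := exists_nat_gt (T / (h₀ / 2))
    rw [div_lt_iff₀ (by positivity)] at hn
    obtain ⟨a, ha⟩ := exists_tendsto_ultrafilter_of_norm_le U (C := n)
      (u := fun m => pushLength (L m) (κ m t)) (by
        filter_upwards [hτs (h₀ / 2) (by positivity), hsmall ε₀ hε₀] with m hm hmε
        rw [Real.norm_of_nonneg ((hs m).pushLength_nonneg (hκN m t ht))]
        exact (hs m).pushLength_le hm (H _ _ _ _ _ (hs m) hmε) n _ (hκN m t ht)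
          ((hκmem m t ht).2.trans hn.le))
    exact ⟨a, fun _ => ha⟩
  have hlex : ∀ t, ∃ a, t ∈ Icc 0 T →
      Tendsto (fun m => pushVector ψ (τ m) (x m) (κ m t)) U (𝓝 a) := by
    intro t
    by_cases ht : t ∈ Icc 0 T
    swap
    · exact ⟨0, fun h0 => (ht h0).elim⟩
    obtain ⟨C, hC⟩ := isCompact_Icc.exists_bound_of_continuousOn hψ
    obtain ⟨a, ha⟩ := exists_tendsto_ultrafilter_of_norm_le U (C := R + C)
      (u := fun m => pushVector ψ (τ m) (x m) (κ m t)) (Eventually.of_forall fun m =>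
        (norm_sub_le _ _).trans (add_le_add (h.norm_le_of_mem (hκmem m t ht)
          ((hs m).mem _ (hκN m t ht))) (hC _ (hκmem m t ht))))
    exact ⟨a, fun _ => ha⟩
  choose v hv using hvex
  choose l hl using hlex
  have hxlim : ∀ t ∈ Icc 0 T, Tendsto (fun m => x m (κ m t)) U (𝓝 (ψ t + l t)) := fun t ht => by
    refine ((hψlim t ht).add (hl t ht)).congr fun m => ?_
    simp only [pushVector]
    abel
  have hγlim : ∀ t ∈ Icc 0 T, Tendsto (fun m => γ (κ m t * τ m) (x m (κ m t))) U
      (𝓝 (γ t (ψ t + l t))) := fun t ht =>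
    (h.continuousOn (t, ψ t + l t) ⟨ht, mem_univ _⟩).tendsto.comp (tendsto_nhdsWithin_iff.2
      ⟨(hκlim t ht).prodMk_nhds (hxlim t ht),
        Eventually.of_forall fun m => ⟨hκmem m t ht, mem_univ _⟩⟩)
  have h0T : (0 : ℝ) ∈ Icc 0 T := ⟨le_rfl, hT.le⟩
  refine ⟨l, v, ?_, ?_, fun t ht => ?_, fun η hη => ?_, fun s hsT hsD => ?_⟩
  · refine tendsto_nhds_unique (hl 0 h0T) (tendsto_const_nhds.congr fun m => ?_)
    simp [hκ, pushVector, (hs m).zero]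
  · refine tendsto_nhds_unique (hv 0 h0T) (tendsto_const_nhds.congr fun m => ?_)
    simp [hκ, pushLength]
  · rw [mem_closure_iff_infDist_zero (h.nonempty t ht)]
    refine le_antisymm (le_of_forall_pos_le_add fun η hη => ?_) infDist_nonneg
    obtain ⟨c, hc, H⟩ := h.modulus_dist η hη
    rw [zero_add]
    refine le_of_tendsto (((continuous_infDist_pt (D t)).tendsto _).comp (hxlim t ht)) ?_
    filter_upwards [hτs c hc] with m hm
    refine H _ (hκmem m t ht) t ht ?_ _ ((hs m).mem _ (hκN m t ht))
    rw [abs_le]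
    constructor <;> linarith [hκ1 m t ht, hκ2 m t]
  · obtain ⟨h₀, hh₀, ε₀, hε₀, H⟩ := h.exists_scheme_estimate hψ hη
    -- Half of `h₀` is kept for the rounding of `s` to the grid.
    refine ⟨h₀ / 2, by positivity, fun s hsT t htT hst hts => ?_⟩
    have hfine : ∀ᶠ m : ℕ in (U : Filter ℕ), τ m ≤ h₀ / 2 ∧ 1 / ((m : ℝ) + 1) ≤ ε₀ :=
      (hτs (h₀ / 2) (by positivity)).and (hsmall ε₀ hε₀)
    have hest := fun (m : ℕ) (hm : τ m ≤ h₀ / 2 ∧ 1 / ((m : ℝ) + 1) ≤ ε₀) =>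
      H _ _ _ _ _ (hs m) hm.2 (κ m s) (κ m t) (hκmono m s t hst) (hκN m t htT) (by
        rw [sub_mul]
        linarith [hκ1 m t htT, hκ2 m s])
    have hvst := (hv t htT).sub (hv s hsT)
    have hγs := hγlim s hsT
    refine ⟨ge_of_tendsto hvst (Eventually.of_forall fun m => sub_nonneg.2
      ((hs m).pushLength_mono (hκmono m s t hst) (hκN m t htT))),
      le_of_tendsto hvst (hfine.mono fun m hm => (hest m hm).1),
      le_of_tendsto_of_tendsto (((hl t htT).sub (hl s hsT)).sub (hvst.smul hγs)).norm
        (hvst.const_mul η) (hfine.mono fun m hm => (hest m hm).2.2.1),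
      le_of_tendsto_of_tendsto ((hγs.norm.sub_const 1).abs.mul hvst) (hvst.const_mul η)
        (hfine.mono fun m hm => (hest m hm).2.2.2)⟩
  · obtain ⟨h₁, hh₁, H₁⟩ := h.open_time s hsT _ hsD
    obtain ⟨h₀, hh₀, ε₀, hε₀, H⟩ := h.exists_scheme_estimate hψ (half_pos hh₁)
    -- With `τ m ≤ c`, all nodes between those of `s` and `t` have times in `[s - 2c, s + c]`,
    -- within both windows `h₀` and `h₁`. The radius `h₁` is split between the oscillation of the
    -- scheme and its distance to the limit at `s`.
    set c := min h₀ h₁ / 2 with hc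
    have hc0 : 0 < c := by positivity
    have hch₀ : 2 * c ≤ h₀ := by rw [hc]; linarith [min_le_left h₀ h₁]
    have hch₁ : 2 * c ≤ h₁ := by rw [hc]; linarith [min_le_right h₀ h₁]
    refine ⟨c, hc0, fun t htT hts => tendsto_nhds_unique_of_eventuallyEq (hv t htT) (hv s hsT) ?_⟩
    filter_upwards [hτs c hc0, hsmall ε₀ hε₀,
      (Metric.tendsto_nhds.1 (hxlim s hsT)) (h₁ / 2) (by positivity)] with m hm hmε hmx
    rw [dist_eq_norm] at hmx
    rw [abs_le] at hts
    have e1 := hκ1 m s hsT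
    have e2 := hκ2 m s
    have e3 := hκ1 m t htT
    have e4 := hκ2 m t
    have hD : ∀ i, min (κ m s) (κ m t) ≤ i → i ≤ max (κ m s) (κ m t) →
        x m i ∈ D (i * τ m) := by
      intro i hi1 hi2
      have hiN : i ≤ N m := hi2.trans (max_le (hκN m s hsT) (hκN m t htT))
      have hlow : s - 2 * c ≤ i * τ m := by
        rcases min_le_iff.1 hi1 with hi | hi
        · have := mul_le_mul_of_nonneg_right (Nat.cast_le (α := ℝ).2 hi) (hτ0 m).le
          linarith
        · have := mul_le_mul_of_nonneg_right (Nat.cast_le (α := ℝ).2 hi) (hτ0 m).le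
          linarith
      have hup : i * τ m ≤ s + c := by
        rcases le_max_iff.1 hi2 with hi | hi
        · have := mul_le_mul_of_nonneg_right (Nat.cast_le (α := ℝ).2 hi) (hτ0 m).le
          linarith
        · have := mul_le_mul_of_nonneg_right (Nat.cast_le (α := ℝ).2 hi) (hτ0 m).le
          linarith
      refine H₁ _ ((hs m).time_mem hiN) (abs_le.2 ⟨by linarith, by linarith⟩) _ ?_
      have hxi : ‖x m i - x m (κ m s)‖ ≤ h₁ / 2 := by
        rcases le_total (κ m s) i with hi | hi
        · exact (H _ _ _ _ _ (hs m) hmε _ _ hi hiN (by rw [sub_mul]; linarith)).2.1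
        · rw [norm_sub_rev]
          exact (H _ _ _ _ _ (hs m) hmε _ _ hi (hκN m s hsT) (by rw [sub_mul]; linarith)).2.1
      rw [dist_eq_norm]
      have := norm_add_le (x m i - x m (κ m s)) (x m (κ m s) - (ψ s + l s))
      rw [sub_add_sub_cancel] at this
      linarith
    have := (hs m).pushLength_eq h.isOpen min_le_max
      (max_le (hκN m s hsT) (hκN m t htT)) hD
    rcases le_total (κ m s) (κ m t) with hle | hle
    · rwa [max_eq_right hle, min_eq_left hle] at this
    · rw [max_eq_left hle, min_eq_right hle] at this
      exact this.symm

end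

/-! ### From local estimates to the total variation. -/

section

/-- Increments of `w` are additive, so local bounds chain by the triangle inequality. Used with `w`
a small multiple of `v`, it shows that accumulated local errors vanish. -/
theorem dist_le_of_local {F : Type*} [PseudoMetricSpace F] {T : ℝ} {f : ℝ → F} {w : ℝ → ℝ} {h : ℝ}
    (hh : 0 < h) (hloc : ∀ s ∈ Icc 0 T, ∀ t ∈ Icc 0 T, s ≤ t → t ≤ s + h →
      dist (f s) (f t) ≤ w t - w s) {s t : ℝ} (hs : s ∈ Icc 0 T) (ht : t ∈ Icc 0 T) (hst : s ≤ t) :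
    dist (f s) (f t) ≤ w t - w s := by
  have key : ∀ n : ℕ, ∀ t ∈ Icc 0 T, s ≤ t → t ≤ s + n * h → dist (f s) (f t) ≤ w t - w s := by
    intro n
    induction n with
    | zero =>
      intro t ht h1 h2
      have : t = s := by
        simp only [Nat.cast_zero, zero_mul, add_zero] at h2
        exact le_antisymm h2 h1
      simp [this]
    | succ n ih =>
      intro t ht h1 h2
      push_cast at h2
      by_cases h3 : t ≤ s + h
      · exact hloc s hs t ht h1 h3
      have ht' : t - h ∈ Icc 0 T := ⟨by linarith [hs.1], by linarith [ht.2]⟩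
      have h4 := ih (t - h) ht' (by linarith) (by linarith)
      have h5 := hloc (t - h) ht' t ht (by linarith) (by linarith)
      linarith [dist_triangle (f s) (f (t - h)) (f t)]
  obtain ⟨n, hn⟩ := exists_nat_gt ((t - s) / h)
  rw [div_lt_iff₀ hh] at hn
  exact key n t ht hst (by linarith)

theorem eVariationOn_le_of_dist_le {F : Type*} [PseudoMetricSpace F] {f : ℝ → F} {w : ℝ → ℝ}
    {a b : ℝ} (hf : ∀ s ∈ Icc a b, ∀ t ∈ Icc a b, s ≤ t → dist (f s) (f t) ≤ w t - w s) :
    eVariationOn f (Icc a b) ≤ ENNReal.ofReal (w b - w a) := by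
  refine iSup_le fun p => ?_
  obtain ⟨n, u, hu, hmem⟩ := p
  have hab : a ≤ b := (hmem 0).1.trans (hmem 0).2
  have hw : ∀ s ∈ Icc a b, ∀ t ∈ Icc a b, s ≤ t → w s ≤ w t := fun s hs t ht hst =>
    sub_nonneg.1 (dist_nonneg.trans (hf s hs t ht hst))
  calc ∑ i ∈ Finset.range n, edist (f (u (i + 1))) (f (u i))
      ≤ ∑ i ∈ Finset.range n, ENNReal.ofReal (w (u (i + 1)) - w (u i)) := by
        refine Finset.sum_le_sum fun i _ => ?_
        rw [edist_comm, edist_dist]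
        exact ENNReal.ofReal_le_ofReal (hf _ (hmem i) _ (hmem (i + 1)) (hu i.le_succ))
    _ = ENNReal.ofReal (w (u n) - w (u 0)) := by
        rw [← ENNReal.ofReal_sum_of_nonneg fun i _ =>
          sub_nonneg.2 (hw _ (hmem i) _ (hmem (i + 1)) (hu i.le_succ)),
          Finset.sum_range_sub (fun i => w (u i))]
    _ ≤ ENNReal.ofReal (w b - w a) := ENNReal.ofReal_le_ofReal (sub_le_sub
        (hw _ (hmem n) b ⟨hab, le_rfl⟩ (hmem n).2) (hw a ⟨le_rfl, hab⟩ _ (hmem 0) (hmem 0).1))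

theorem eVariationOn_Icc_add_Icc {F : Type*} [PseudoEMetricSpace F] (f : ℝ → F) {a b c : ℝ}
    (hab : a ≤ b) (hbc : b ≤ c) :
    eVariationOn f (Icc a b) + eVariationOn f (Icc b c) = eVariationOn f (Icc a c) := by
  simpa using eVariationOn.Icc_add_Icc f (s := univ) hab hbc (mem_univ b)

variable {E : Type*} [NormedAddCommGroup E] [NormedSpace ℝ E] {T : ℝ} {D : ℝ → Set E}
  {γ : ℝ → E → E} {ψ l : ℝ → E} {v : ℝ → ℝ}

theorem IsLimitPush.exists_norm_estimate (H : IsLimitPush T D γ ψ l v) {η : ℝ} (hη : 0 < η) :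
    ∃ h > 0, ∀ s ∈ Icc 0 T, ∀ t ∈ Icc 0 T, s ≤ t → t ≤ s + h →
      ‖l t - l s‖ ≤ (1 + η) * (v t - v s) ∧ (1 - η) * (v t - v s) ≤ ‖l t - l s‖ := by
  obtain ⟨h, hh, He⟩ := H.estimate (η / 2) (half_pos hη)
  refine ⟨h, hh, fun s hs t ht hst hts => ?_⟩
  obtain ⟨h0, -, h1, h2⟩ := He s hs t ht hst hts
  set g := γ s (ψ s + l s)
  set a := v t - v s
  have h3 : |‖l t - l s‖ - a * ‖g‖| ≤ η / 2 * a := by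
    have : a * ‖g‖ = ‖a • g‖ := by rw [norm_smul, Real.norm_of_nonneg h0]
    rw [this]
    exact (abs_norm_sub_norm_le _ _).trans h1
  have h4 : |(‖g‖ - 1) * a| ≤ η / 2 * a := by rwa [abs_mul, abs_of_nonneg h0]
  rw [abs_le] at h3 h4
  constructor <;> nlinarith

theorem IsLimitPush.monotoneOn (H : IsLimitPush T D γ ψ l v) {s t : ℝ} (hs : s ∈ Icc 0 T)
    (ht : t ∈ Icc 0 T) (hst : s ≤ t) : v s ≤ v t := by
  obtain ⟨h, hh, He⟩ := H.estimate 1 one_pos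
  -- For a constant `f` the chaining just says that local monotonicity of `v` is global.
  have := dist_le_of_local (f := fun _ => (0 : ℝ)) hh
    (fun s hs t ht hst hts => by simpa using (He s hs t ht hst hts).1) hs ht hst
  simpa using this

theorem IsLimitPush.norm_sub_le (H : IsLimitPush T D γ ψ l v) {s t : ℝ} (hs : s ∈ Icc 0 T)
    (ht : t ∈ Icc 0 T) (hst : s ≤ t) : ‖l t - l s‖ ≤ 2 * (v t - v s) := by
  obtain ⟨h, hh, He⟩ := H.exists_norm_estimate one_pos
  have := dist_le_of_local (f := l) (w := fun t => 2 * v t) hh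
    (fun s hs t ht hst hts => by
      rw [dist_comm, dist_eq_norm]
      linarith [(He s hs t ht hst hts).1]) hs ht hst
  rw [dist_comm, dist_eq_norm] at this
  linarith

theorem IsLimitPush.continuousOn_length (H : IsLimitPush T D γ ψ l v) :
    ContinuousOn v (Icc 0 T) := by
  refine Metric.continuousOn_iff.2 fun s hs ε hε => ?_
  obtain ⟨h, hh, He⟩ := H.estimate (ε / 2) (half_pos hε)
  refine ⟨h, hh, fun t ht hts => ?_⟩
  rw [Real.dist_eq, abs_lt] at hts
  rw [Real.dist_eq, abs_lt]
  rcases le_total s t with hst | hst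
  · have := He s hs t ht hst (by linarith)
    constructor <;> linarith [this.1, this.2.1]
  · have := He t ht s hs hst (by linarith)
    constructor <;> linarith [this.1, this.2.1]

theorem IsLimitPush.continuousOn (H : IsLimitPush T D γ ψ l v) : ContinuousOn l (Icc 0 T) := by
  refine Metric.continuousOn_iff.2 fun s hs ε hε => ?_
  obtain ⟨δ, hδ, Hc⟩ := Metric.continuousOn_iff.1 H.continuousOn_length s hs (ε / 2) (half_pos hε)
  refine ⟨δ, hδ, fun t ht hts => ?_⟩
  have := Hc t ht hts
  rw [Real.dist_eq, abs_lt] at this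
  rcases le_total s t with hst | hst
  · rw [dist_eq_norm]
    linarith [H.norm_sub_le hs ht hst]
  · rw [dist_comm, dist_eq_norm]
    linarith [H.norm_sub_le ht hs hst]

theorem IsLimitPush.boundedVariationOn (H : IsLimitPush T D γ ψ l v) :
    BoundedVariationOn l (Icc 0 T) :=
  ((eVariationOn_le_of_dist_le (w := fun t => 2 * v t) fun s hs t ht hst => by
    rw [dist_comm, dist_eq_norm, ← mul_sub]
    exact H.norm_sub_le hs ht hst).trans_lt ENNReal.ofReal_lt_top).ne

/-- On short intervals the variation of `l` lies between `(1 - η)` and `(1 + η)` times the increment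
of `v`. Chaining bounds the difference of the two functions by `η * v t`, for every `η > 0`. -/
theorem IsLimitPush.toReal_eVariationOn (H : IsLimitPush T D γ ψ l v) {t : ℝ} (ht : t ∈ Icc 0 T) :
    (eVariationOn l (Icc 0 t)).toReal = v t := by
  have hfin : ∀ a b, 0 ≤ a → b ≤ T → eVariationOn l (Icc a b) ≠ ⊤ := fun a b ha hb =>
    H.boundedVariationOn.mono (Icc_subset_Icc ha hb)
  have h0T : (0 : ℝ) ∈ Icc 0 T := ⟨le_rfl, ht.1.trans ht.2⟩
  set V : ℝ → ℝ := fun t => (eVariationOn l (Icc 0 t)).toReal with hV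
  have hloc : ∀ η > 0, ∃ h > 0, ∀ s ∈ Icc 0 T, ∀ t ∈ Icc 0 T, s ≤ t → t ≤ s + h →
      dist (V s - v s) (V t - v t) ≤ η * v t - η * v s := by
    intro η hη
    obtain ⟨h, hh, He⟩ := H.exists_norm_estimate hη
    refine ⟨h, hh, fun s hs t ht hst hts => ?_⟩
    have hadd : V t = V s + (eVariationOn l (Icc s t)).toReal := by
      rw [hV]
      simp only
      rw [← eVariationOn_Icc_add_Icc l hs.1 hst, ENNReal.toReal_add (hfin _ _ le_rfl hs.2)
        (hfin _ _ hs.1 ht.2)]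
    have hvst := H.monotoneOn hs ht hst
    have hub : (eVariationOn l (Icc s t)).toReal ≤ (1 + η) * (v t - v s) := by
      refine ENNReal.toReal_le_of_le_ofReal (mul_nonneg (by linarith) (by linarith)) ?_
      rw [mul_sub]
      refine eVariationOn_le_of_dist_le (w := fun t => (1 + η) * v t) fun a ha b hb hab => ?_
      rw [dist_comm, dist_eq_norm, ← mul_sub]
      exact (He a ⟨hs.1.trans ha.1, ha.2.trans ht.2⟩ b ⟨hs.1.trans hb.1, hb.2.trans ht.2⟩ hab
        (by linarith [ha.1, hb.2])).1
    have hlb : (1 - η) * (v t - v s) ≤ (eVariationOn l (Icc s t)).toReal := by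
      refine (He s hs t ht hst hts).2.trans ?_
      have := ENNReal.toReal_mono (hfin _ _ hs.1 ht.2)
        (eVariationOn.edist_le l (right_mem_Icc.2 hst) (left_mem_Icc.2 hst))
      rwa [edist_dist, ENNReal.toReal_ofReal dist_nonneg, dist_eq_norm] at this
    rw [Real.dist_eq, abs_le, hadd]
    constructor <;> linarith
  have hV0 : V 0 = 0 := by simp [hV, eVariationOn.subsingleton]
  have hv0 : 0 ≤ v t := by
    rw [← H.zero_length]
    exact H.monotoneOn h0T ht ht.1
  have hle : ∀ η > 0, |V t - v t| ≤ η * v t := fun η hη => by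
    obtain ⟨h, hh, He⟩ := hloc η hη
    have := dist_le_of_local (f := fun t => V t - v t) (w := fun t => η * v t) hh He h0T ht ht.1
    rwa [Real.dist_eq, hV0, H.zero_length, sub_zero, mul_zero, sub_zero, zero_sub, abs_neg] at this
  have : |V t - v t| ≤ 0 := by
    refine le_of_forall_pos_le_add fun ε hε => ?_
    refine (hle (ε / (v t + 1)) (by positivity)).trans ?_
    rw [zero_add, div_mul_eq_mul_div, div_le_iff₀ (by positivity)]
    nlinarith
  exact sub_eq_zero.1 (abs_nonpos_iff.1 this)

end

/-! ### The variation measure and the integral representation. -/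

section

variable {n : ℕ} {T : ℝ} {D : ℝ → Set (EuclideanSpace ℝ (Fin n))}
  {γ : ℝ → EuclideanSpace ℝ (Fin n) → EuclideanSpace ℝ (Fin n)}
  {ψ l : ℝ → EuclideanSpace ℝ (Fin n)} {v : ℝ → ℝ}

theorem IsLimitPush.totalVariation_eq (hT : 0 < T) (H : IsLimitPush T D γ ψ l v) (t : ℝ) :
    totalVariation T l t = v (max 0 (min t T)) := by
  rcases le_or_gt 0 t with ht | ht
  · have hm : min t T ∈ Icc 0 T := ⟨le_min ht hT.le, min_le_right _ _⟩
    rw [max_eq_right hm.1, totalVariation, H.toReal_eVariationOn hm]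
  · have h1 : min t T < 0 := (min_le_left _ _).trans_lt ht
    rw [max_eq_left h1.le, H.zero_length, totalVariation, Icc_eq_empty (not_le.2 h1)]
    simp [eVariationOn.subsingleton]

theorem clamp_mem (hT : 0 < T) (t : ℝ) : max 0 (min t T) ∈ Icc 0 T :=
  ⟨le_max_left _ _, max_le hT.le (min_le_right _ _)⟩

theorem clamp_eq {t : ℝ} (ht : t ∈ Icc 0 T) : max 0 (min t T) = t := by
  rw [min_eq_left ht.2, max_eq_right ht.1]

theorem IsLimitPush.variationMeasure_Ioc (hT : 0 < T) (H : IsLimitPush T D γ ψ l v)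
    (hBV : BoundedVariationOn l (Icc 0 T)) (a b : ℝ) :
    variationMeasure hBV (Ioc a b)
      = ENNReal.ofReal (v (max 0 (min b T)) - v (max 0 (min a T))) := by
  -- Continuity makes the right limits in the Stieltjes function harmless.
  have hcont : Continuous (totalVariation T l) := by
    have : totalVariation T l = fun t => v (max 0 (min t T)) := funext (H.totalVariation_eq hT)
    rw [this]
    exact H.continuousOn_length.comp_continuous (by fun_prop) (clamp_mem hT)
  have hst : ∀ t, (monotone_totalVariation hBV).stieltjesFunction t = v (max 0 (min t T)) := by
    intro t
    rw [Monotone.stieltjesFunction_eq, ← H.totalVariation_eq hT]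
    exact rightLim_eq_of_tendsto hcont.continuousWithinAt.tendsto
  rw [variationMeasure, StieltjesFunction.measure_Ioc, hst, hst]

/-- Around each point of this set the clamped `v` is constant, so the set is locally null and
therefore null. -/
theorem IsLimitPush.variationMeasure_null (hT : 0 < T) (H : IsLimitPush T D γ ψ l v)
    (hBV : BoundedVariationOn l (Icc 0 T)) :
    variationMeasure hBV {s | s ∉ Icc 0 T ∨ ψ s + l s ∈ D s} = 0 := by
  refine measure_null_of_locally_null _ fun s hs => ?_
  suffices ∃ c > 0, ∀ t, |t - s| ≤ c → v (max 0 (min t T)) = v (max 0 (min s T)) by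
    obtain ⟨c, hc, hv⟩ := this
    refine ⟨Ioc (s - c) (s + c), mem_nhdsWithin_of_mem_nhds
      (Ioc_mem_nhds (by linarith) (by linarith)), ?_⟩
    rw [H.variationMeasure_Ioc hT, hv (s + c) (by simp [abs_of_pos hc]),
      hv (s - c) (by simp [abs_of_pos hc]), sub_self, ENNReal.ofReal_zero]
  by_cases hsT : s ∈ Icc 0 T
  · obtain ⟨c, hc, hv⟩ := H.constant s hsT (hs.resolve_left (not_not.2 hsT))
    refine ⟨c, hc, fun t ht => ?_⟩
    rw [clamp_eq hsT]
    refine hv _ (clamp_mem hT t) ?_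
    have h1 : |max 0 (min t T) - max 0 (min s T)| ≤ |t - s| := by
      have h2 := abs_max_sub_max_le_max 0 (min t T) 0 (min s T)
      have h3 := abs_min_sub_min_le_max t T s T
      simp only [sub_self, abs_zero] at h2 h3
      rw [max_eq_right (abs_nonneg (min t T - min s T))] at h2
      rw [max_eq_left (abs_nonneg (t - s))] at h3
      exact h2.trans h3
    rw [clamp_eq hsT] at h1
    exact h1.trans ht
  · rw [mem_Icc, not_and_or, not_le, not_le] at hsT
    rcases hsT with hs0 | hsT
    · refine ⟨-s, by linarith, fun t ht => ?_⟩
      rw [abs_le] at ht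
      rw [max_eq_left ((min_le_left t T).trans (by linarith)),
        max_eq_left ((min_le_left s T).trans hs0.le)]
    · refine ⟨s - T, by linarith, fun t ht => ?_⟩
      rw [abs_le] at ht
      rw [min_eq_right (by linarith : T ≤ t), min_eq_right hsT.le]

/-- Over a short interval both sides grow by `γ`, frozen at the left end, times the increment of
`v`, each up to `η` times that increment; chaining and `η → 0` give equality. -/
theorem IsLimitPush.eq_integral (hT : 0 < T) (H : IsLimitPush T D γ ψ l v)
    (hBV : BoundedVariationOn l (Icc 0 T))
    (hγφ : ContinuousOn (fun s => γ s (ψ s + l s)) (Icc 0 T))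
    {γ' : ℝ → EuclideanSpace ℝ (Fin n)} (hγ' : EqOn γ' (fun s => γ s (ψ s + l s)) (Icc 0 T))
    (hint : IntegrableOn γ' (Ioc 0 T) (variationMeasure hBV)) {t : ℝ} (ht : t ∈ Icc 0 T) :
    l t = ∫ s in Ioc 0 t, γ' s ∂(variationMeasure hBV) := by
  set μ := variationMeasure hBV with hμ
  have h0T : (0 : ℝ) ∈ Icc 0 T := ⟨le_rfl, hT.le⟩
  have hμI : ∀ s ∈ Icc 0 T, ∀ t ∈ Icc 0 T, μ (Ioc s t) = ENNReal.ofReal (v t - v s) :=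
    fun s hs t ht => by rw [hμ, H.variationMeasure_Ioc hT, clamp_eq hs, clamp_eq ht]
  set G : ℝ → EuclideanSpace ℝ (Fin n) := fun t => l t - ∫ s in Ioc 0 t, γ' s ∂μ with hG
  have hloc : ∀ η > 0, ∃ h > 0, ∀ s ∈ Icc 0 T, ∀ t ∈ Icc 0 T, s ≤ t → t ≤ s + h →
      dist (G s) (G t) ≤ 2 * η * v t - 2 * η * v s := by
    intro η hη
    obtain ⟨h₁, hh₁, H₁⟩ := H.estimate η hη
    obtain ⟨h₂, hh₂, H₂⟩ := exists_modulus_of_continuousOn hγφ hη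
    refine ⟨min h₁ h₂, by positivity, fun s hs t ht hst hts => ?_⟩
    have hts1 := hts.trans (add_le_add_right (min_le_left h₁ h₂) s)
    have hts2 := hts.trans (add_le_add_right (min_le_right h₁ h₂) s)
    obtain ⟨h0, -, h1, -⟩ := H₁ s hs t ht hst hts1
    have hi1 : IntegrableOn γ' (Ioc 0 s) μ := hint.mono_set (Ioc_subset_Ioc_right hs.2)
    have hi2 : IntegrableOn γ' (Ioc s t) μ := hint.mono_set (Ioc_subset_Ioc hs.1 ht.2)
    have hsplit : ∫ u in Ioc 0 t, γ' u ∂μ = (∫ u in Ioc 0 s, γ' u ∂μ) + ∫ u in Ioc s t, γ' u ∂μ := by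
      rw [← setIntegral_union (Ioc_disjoint_Ioc_of_le le_rfl) measurableSet_Ioc hi1 hi2,
        Ioc_union_Ioc_eq_Ioc hs.1 hst]
    have hfin : μ (Ioc s t) < ⊤ := by rw [hμI s hs t ht]; exact ENNReal.ofReal_lt_top
    have hreal : μ.real (Ioc s t) = v t - v s := by
      rw [Measure.real, hμI s hs t ht, ENNReal.toReal_ofReal h0]
    have h2 : ‖(∫ u in Ioc s t, γ' u ∂μ) - (v t - v s) • γ s (ψ s + l s)‖ ≤ η * (v t - v s) := by
      rw [← hreal, ← setIntegral_const, ← integral_sub hi2 (integrableOn_const hfin.ne)]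
      refine norm_setIntegral_le_of_norm_le_const hfin fun u hu => ?_
      have huT : u ∈ Icc 0 T := ⟨hs.1.trans hu.1.le, hu.2.trans ht.2⟩
      rw [hγ' huT]
      refine H₂ s hs u huT (abs_le.2 ⟨?_, ?_⟩)
      · linarith [hu.2]
      · linarith [hu.1]
    rw [dist_comm, dist_eq_norm]
    have e : G t - G s = (l t - l s - (v t - v s) • γ s (ψ s + l s))
        - ((∫ u in Ioc s t, γ' u ∂μ) - (v t - v s) • γ s (ψ s + l s)) := by
      rw [hG]
      simp only
      rw [hsplit]
      abel
    rw [e]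
    refine (_root_.norm_sub_le _ _).trans ?_
    linarith
  have hG0 : G 0 = 0 := by simp [hG, H.zero_vector]
  have hv0 : 0 ≤ v t := by
    rw [← H.zero_length]
    exact H.monotoneOn h0T ht ht.1
  have hle : ∀ η > 0, ‖G t‖ ≤ 2 * η * v t := fun η hη => by
    obtain ⟨h, hh, He⟩ := hloc η hη
    have := dist_le_of_local (w := fun t => 2 * η * v t) hh He h0T ht ht.1
    rwa [hG0, H.zero_length, dist_zero_left, mul_zero, sub_zero] at this
  have : ‖G t‖ ≤ 0 := by
    refine le_of_forall_pos_le_add fun ε hε => ?_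
    refine (hle (ε / (2 * (v t + 1))) (by positivity)).trans ?_
    rw [zero_add]
    field_simp
    linarith
  exact sub_eq_zero.1 (norm_le_zero_iff.1 this)

end

/-! ### Assembly of the Skorohod solution. -/

theorem IsLimitPush.isSkorohodSolution {n : ℕ} {T : ℝ} (hT : 0 < T)
    {Ω : Set (ℝ × EuclideanSpace ℝ (Fin n))}
    {γ : ℝ → EuclideanSpace ℝ (Fin n) → EuclideanSpace ℝ (Fin n)}
    {ψ l : ℝ → EuclideanSpace ℝ (Fin n)} {v : ℝ → ℝ}
    (hopen : ∀ t ∈ Icc 0 T, IsOpen (timeSection Ω t))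
    (hγ : ContinuousOn (fun p : ℝ × EuclideanSpace ℝ (Fin n) => γ p.1 p.2) (Icc 0 T ×ˢ univ))
    (hψ : ContinuousOn ψ (Icc 0 T)) (H : IsLimitPush T (timeSection Ω) γ ψ l v) :
    IsSkorohodSolution T Ω γ ψ (fun t => ψ t + l t) l := by
  have hBV := H.boundedVariationOn
  have h0T : (0 : ℝ) ∈ Icc 0 T := ⟨le_rfl, hT.le⟩
  have hγφ : ContinuousOn (fun s => γ s (ψ s + l s)) (Icc 0 T) :=
    hγ.comp (continuousOn_id.prodMk (hψ.add H.continuousOn)) fun s hs => ⟨hs, mem_univ _⟩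
  have hnull := H.variationMeasure_null hT hBV
  have hae : ∀ᵐ s ∂(variationMeasure hBV), s ∈ Icc 0 T ∧
      ψ s + l s ∈ frontier (timeSection Ω s) := by
    rw [ae_iff]
    refine measure_mono_null (fun s hs => ?_) hnull
    by_contra hcon
    simp only [mem_ofPred_eq, not_or, not_not] at hcon
    refine hs ⟨hcon.1, H.mem_closure s hcon.1, ?_⟩
    rw [(hopen s hcon.1).interior_eq]
    exact hcon.2
  have hfin : variationMeasure hBV (Ioc 0 T) < ⊤ := by
    rw [H.variationMeasure_Ioc hT]
    exact ENNReal.ofReal_lt_top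
  -- Truncation makes the direction measurable on all of `ℝ`; the variation measure does not charge
  -- the complement of `[0, T]`.
  set γ' : ℝ → EuclideanSpace ℝ (Fin n) := (Icc 0 T).indicator fun s => γ s (ψ s + l s) with hγ'
  have hγ'eq : EqOn γ' (fun s => γ s (ψ s + l s)) (Icc 0 T) := fun s hs => indicator_of_mem hs _
  have hγ'meas : Measurable γ' := by
    classical
    rw [hγ', ← piecewise_eq_indicator]
    exact hγφ.measurable_piecewise continuousOn_const measurableSet_Icc
  obtain ⟨C, hC⟩ := isCompact_Icc.exists_bound_of_continuousOn hγφ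
  have hγ'int : IntegrableOn γ' (Ioc 0 T) (variationMeasure hBV) := by
    refine IntegrableOn.of_bound hfin hγ'meas.aestronglyMeasurable C ?_
    filter_upwards [ae_restrict_of_ae hae] with s hs
    rw [hγ'eq hs.1]
    exact hC s hs.1
  refine ⟨hψ.add H.continuousOn, H.continuousOn, fun t _ => rfl, by simp [H.zero_vector],
    H.mem_closure, hBV, fun t ht => ?_, γ', hγ'meas, ?_, hγ'int,
    fun t ht => H.eq_integral hT hBV hγφ hγ'eq hγ'int ht⟩
  · have h1 : ∫⁻ s in Ioc 0 t, {s | ψ s + l s ∈ frontier (timeSection Ω s)}.indicator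
        (fun _ => (1 : ℝ≥0∞)) s ∂(variationMeasure hBV) = variationMeasure hBV (Ioc 0 t) := by
      rw [← setLIntegral_one]
      refine lintegral_congr_ae ?_
      filter_upwards [ae_restrict_of_ae hae] with s hs
      exact indicator_of_mem (s := {s | ψ s + l s ∈ frontier (timeSection Ω s)}) hs.2 _
    rw [h1, H.variationMeasure_Ioc hT, clamp_eq ht, clamp_eq h0T, H.zero_length, sub_zero,
      ← H.toReal_eVariationOn ht, ENNReal.ofReal_toReal
        (hBV.mono (Icc_subset_Icc_right ht.2))]
  · filter_upwards [hae] with s hs using hγ'eq hs.1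


end ObliqueSkorohod

theorem theorem4p5 (n : ℕ) (hn : 1 ≤ n) (T : ℝ) (hT : 0 < T)
    (Ω : Set (ℝ × EuclideanSpace ℝ (Fin n)))
    (γ : ℝ → EuclideanSpace ℝ (Fin n) → EuclideanSpace ℝ (Fin n))
    (hΩγ : ObliqueSkorohod.IsAdmissible T Ω γ)
    (ψ : ℝ → EuclideanSpace ℝ (Fin n)) (hψ : ContinuousOn ψ (Set.Icc (0 : ℝ) T))
    (hψ0 : ψ 0 ∈ closure (ObliqueSkorohod.timeSection Ω 0)) :
    ∃ φ l : ℝ → EuclideanSpace ℝ (Fin n),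
      ObliqueSkorohod.IsSkorohodSolution T Ω γ ψ φ l := by
  obtain ⟨R, ρ, M, h⟩ := hΩγ.exists_isUniformDomain
  obtain ⟨l, v, H⟩ := h.exists_isLimitPush hT hψ hψ0
  exact ⟨_, l, H.isSkorohodSolution hT h.isOpen h.continuousOn hψ⟩
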